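/- Let $G=(V,E)$ be a finite simple graph. For $S\subseteq V$ let $\delta(S)$ be the set of edges with exactly one endpoint in $S$ and $E(S)$ the set of edges with both endpoints in $S$; write $\delta(v)=\delta(\{v\})$, and $x(F)=\sum_{e\in F}x_e$ for $x\in\mathbb{R}^E$, $F\subseteq E$. Let $$\mathrm{Sp}(G)=\{x\in\mathbb{R}^E : x\ge 0,\ x(E(U))\le |U|-1 \text{ for all } \emptyset\ne U\subseteq V,\ x(E)=|V|-1\}$$ (the spanning tree polytope). For a family $\mathcal{A}$ of subsets of $V$, a *Gao-tree* for $\mathcal{A}$ is a spanning tree of $G$ that contains exactly one edge of $\delta(A)$ for every $A\in\mathcal{A}$; spanning trees are identified with their incidence vectors in $\mathbb{R}^E$. For a chain $\emptyset\ne V_0\subsetneq V_1\subsetneq\dots\subsetneq V_k\subsetneq V$ of vertex sets, a point $x\in\mathbb{R}^E$ is a *chain-point* for the chain if (i) $x\in\mathrm{Sp}(G)$; (ii) $x(\delta(V_0))=x(\delta(V_k))=1$ and $x(\delta(V_i))<2$ for $1\le i\le k-1$; (iii) $\sum_{v\in V_i\setminus V_{i-1}}x(\delta(v))=2\,|V_i\setminus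 V_{i-1}|$ for $1\le i\le k$. Its *narrow cut sizes* are the values $x(\delta(V_i))$, $0\le i\le k$. **Theorem.** (a) Every chain-point $x$ for a chain $V_0\subsetneq\dots\subsetneq V_k$ admits a layered convex combination: the distinct narrow cut sizes can be written as $2-\lambda_1>2-\lambda_1-\lambda_2>\dots>2-\lambda_1-\dots-\lambda_\ell=1$ with $\lambda_1,\dots,\lambda_\ell>0$ (so $\sum_j\lambda_j=1$), and there are points $x_1,\dots,x_\ell\in\mathbb{R}^E$ such that $x=\sum_{j=1}^{\ell}\lambda_jx_j$ and each $x_j$ lies in the convex hull of the Gao-trees for the subchain $\{V_i : x(\delta(V_i))\le 2-\lambda_1-\dots-\lambda_j\}$. (b) In particular, let $s,t\in V$ and let $x$ be a solution of the $s$–$t$ path TSP subtour elimination LP, i.e. $x\in\mathrm{Sp}(G)$, $x(\delta(v))=2$ for all $v\in V\setminus\{s,t\}$, and $x(\delta(s))=x(\delta(t))=1$. Then the sets $A\subseteq V\setminus\{t\}$ with $s\in A$ and $x(\delta(A))<2$ form a chain $\{s\}=V_0\subsetneq\dots\subsetneq V_k=V\setminus\{t\}$, $x$ is a chain-point for this chain,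 and $x$ admits a layered convex combination with respect to it. Moreover (the Gottschalk–Vygen theorem), $x$ is a convex combination of spanning trees of $G$ such that for every $\lambda\in[0,1]$ the coefficients of the Gao-trees for $\{A\subseteq V\setminus\{t\} : s\in A,\ x(\delta(A))\le 2-\lambda\}$ sum to at least $\lambda$. -/

import Mathlib

namespace PathTSP

/-- `δ(S, T)`: the edges of `G` with one endpoint in `S` and the other in `T`. -/
def edgesBetween {V : Type*} [Fintype V] [DecidableEq V] (G : SimpleGraph V)
    [DecidableRel G.Adj] (S T : Finset V) : Finset G.edgeSet :=
  Finset.univ.filter fun e => ∃ i ∈ S, ∃ j ∈ T, (e : Sym2 V) = s(i, j)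

/-- The cut `δ(S) = δ(S, V ∖ S)`. -/
def cut {V : Type*} [Fintype V] [DecidableEq V] (G : SimpleGraph V)
    [DecidableRel G.Adj] (S : Finset V) : Finset G.edgeSet :=
  edgesBetween G S Sᶜ

/-- `E(S) = δ(S, S)`: the edges of `G` with both endpoints in `S`. -/
def edgesIn {V : Type*} [Fintype V] [DecidableEq V] (G : SimpleGraph V)
    [DecidableRel G.Adj] (S : Finset V) : Finset G.edgeSet :=
  edgesBetween G S S

/-- `x(F) = ∑_{e ∈ F} x_e`. -/
noncomputable def total {E : Type*} (x : E → ℝ) (F : Finset E) : ℝ := ∑ e ∈ F, x e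

/-- The spanning tree polytope `Sp(G)`, given by its inequalities. -/
def spanningTreePolytope {V : Type*} [Fintype V] [DecidableEq V] (G : SimpleGraph V)
    [DecidableRel G.Adj] : Set (G.edgeSet → ℝ) :=
  {x | (∀ e, 0 ≤ x e) ∧
    (∀ U : Finset V, U.Nonempty → total x (edgesIn G U) ≤ (U.card : ℝ) - 1) ∧
    total x Finset.univ = (Fintype.card V : ℝ) - 1}

/-- The edge set `T` is (the edge set of) a spanning tree of `G`. -/
def IsSpanningTree {V : Type*} (G : SimpleGraph V) (T : Finset G.edgeSet) : Prop :=
  (SimpleGraph.fromEdgeSet ((fun e : G.edgeSet => (e : Sym2 V)) '' (T : Set G.edgeSet))).IsTree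

/-- A Gao-tree for a family `𝒞` of vertex sets: a spanning tree that meets each cut `δ(A)`,
`A ∈ 𝒞`, in exactly one edge. -/
def IsGaoTree {V : Type*} [Fintype V] [DecidableEq V] (G : SimpleGraph V)
    [DecidableRel G.Adj] (𝒞 : Set (Finset V)) (T : Finset G.edgeSet) : Prop :=
  IsSpanningTree G T ∧ ∀ A ∈ 𝒞, (T ∩ cut G A).card = 1

/-- The incidence vector of an edge set. -/
noncomputable def incidenceVector {E : Type*} [DecidableEq E] (T : Finset E) : E → ℝ :=
  fun e => if e ∈ T then 1 else 0

/-- The convex hull of (the incidence vectors of) the Gao-trees for `𝒞`. -/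
noncomputable def gaoPolytope {V : Type*} [Fintype V] [DecidableEq V] (G : SimpleGraph V)
    [DecidableRel G.Adj] (𝒞 : Set (Finset V)) : Set (G.edgeSet → ℝ) :=
  convexHull ℝ (incidenceVector '' {T : Finset G.edgeSet | IsGaoTree G 𝒞 T})

/-- `∅ ≠ C 0 ⊊ C 1 ⊊ ⋯ ⊊ C k ⊊ V`. -/
structure IsVertexChain {V : Type*} [Fintype V] {k : ℕ} (C : Fin (k + 1) → Finset V) : Prop where
  nonempty_zero : (C 0).Nonempty
  strictMono : StrictMono C
  last_ne_univ : C (Fin.last k) ≠ Finset.univ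

/-- `x` is a chain-point for the chain `C`. For `i : Fin k` the set `C i.succ \ C i.castSucc`
is a level-set; the first and the last level-set carry no degree condition. -/
structure IsChainPoint {V : Type*} [Fintype V] [DecidableEq V] (G : SimpleGraph V)
    [DecidableRel G.Adj] {k : ℕ} (C : Fin (k + 1) → Finset V) (x : G.edgeSet → ℝ) : Prop where
  mem_polytope : x ∈ spanningTreePolytope G
  cut_zero : total x (cut G (C 0)) = 1
  cut_last : total x (cut G (C (Fin.last k))) = 1
  cut_lt_two : ∀ i, i ≠ 0 → i ≠ Fin.last k → total x (cut G (C i)) < 2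
  level_degrees : ∀ i : Fin k, ∑ v ∈ C i.succ \ C i.castSucc, total x (cut G {v})
    = 2 * ((C i.succ \ C i.castSucc).card : ℝ)

/-- `2 - λ₁ - ⋯ - λⱼ`. -/
noncomputable def layerSize {l : ℕ} (lam : Fin l → ℝ) (j : Fin l) : ℝ :=
  2 - ∑ i ∈ Finset.Iic j, lam i

/-- The numbers `2 - λ₁ > 2 - λ₁ - λ₂ > ⋯ > 2 - λ₁ - ⋯ - λₗ = 1` are exactly the distinct
sizes `x(δ(C i))` (the narrow cut sizes). These conditions determine `l` and `lam`. -/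
structure IsLayering {V : Type*} [Fintype V] [DecidableEq V] (G : SimpleGraph V)
    [DecidableRel G.Adj] {k : ℕ} (C : Fin (k + 1) → Finset V) (x : G.edgeSet → ℝ)
    {l : ℕ} (lam : Fin l → ℝ) : Prop where
  strictAnti : StrictAnti (layerSize lam)
  range_eq : Set.range (layerSize lam) = Set.range fun i => total x (cut G (C i))
  last_eq_one : 2 - ∑ j, lam j = 1

/-- There is a layered convex combination for `x` with respect to the chain `C`. -/
def HasLayeredConvexCombination {V : Type*} [Fintype V] [DecidableEq V] (G : SimpleGraph V)
    [DecidableRel G.Adj] {k : ℕ} (C : Fin (k + 1) → Finset V) (x : G.edgeSet → ℝ) : Prop :=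
  ∃ (l : ℕ) (lam : Fin l → ℝ), IsLayering G C x lam ∧
    (∀ j, 0 < lam j) ∧ ∑ j, lam j = 1 ∧
    ∃ y : Fin l → G.edgeSet → ℝ,
      (∀ j, y j ∈
        gaoPolytope G {A | (∃ i, C i = A) ∧ total x (cut G A) ≤ layerSize lam j}) ∧
      x = ∑ j, lam j • y j

/-- `x` is a solution of the `s`-`t` path TSP subtour elimination LP. -/
structure IsSubtourSolution {V : Type*} [Fintype V] [DecidableEq V] (G : SimpleGraph V)
    [DecidableRel G.Adj] (s t : V) (x : G.edgeSet → ℝ) : Prop where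
  mem_polytope : x ∈ spanningTreePolytope G
  degree_inner : ∀ v, v ≠ s → v ≠ t → total x (cut G {v}) = 2
  degree_source : total x (cut G {s}) = 1
  degree_target : total x (cut G {t}) = 1

open Classical in
/-- The Gottschalk-Vygen property: `x` is a convex combination (with coefficients `p T`) of
spanning trees such that, for every `r ∈ [0, 1]`, the coefficients of the Gao-trees for
`{A ⊆ V ∖ {t} : s ∈ A, x(δ(A)) ≤ 2 - r}` sum to at least `r`. -/
def HasGottschalkVygenCombination {V : Type*} [Fintype V] [DecidableEq V] (G : SimpleGraph V)
    [DecidableRel G.Adj] (s t : V) (x : G.edgeSet → ℝ) : Prop :=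
  ∃ p : Finset G.edgeSet → ℝ,
    (∀ T, 0 ≤ p T) ∧ (∀ T, p T ≠ 0 → IsSpanningTree G T) ∧ ∑ T, p T = 1 ∧
    x = ∑ T, p T • incidenceVector T ∧
    ∀ r : ℝ, 0 ≤ r → r ≤ 1 →
      r ≤ ∑ T with IsGaoTree G {A | s ∈ A ∧ t ∉ A ∧ total x (cut G A) ≤ 2 - r} T, p T

end PathTSP

/-!
Layers are split off one at a time. Let `z` be a point of `s · Sp(G)` that satisfies the scaled
conditions of a chain-point, and let `2 * s - lam` bound the cuts of the chain. The claim is that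
`z = lam • y + (s - lam) • y'` with `y` in the hull of the Gao-trees for the chain and `y'` in `Sp(G)`
(`IsLayered.exists_gaoPolytope_sub_mem`). Then `z - lam • y` satisfies the conditions with `s - lam`
in place of `s`, for the members of the chain whose cut falls below the new bound: every cut of the
chain loses exactly `lam`, and the degree sum of each member of the chain changes by the right
amount. Running through the distinct cut sizes in decreasing order gives the layered convex
combination (`hasLayeredConvexCombination`).

The Gao-trees for a chain are the bases of a matroid, the direct sum of the graphic matroids of the
levels and of the uniform matroids of rank one on the edges between consecutive levels. A point
outside the weighted sum of its base polytope and the spanning tree polytope is separated from it by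
a weight function `c`. The greedy algorithm provides bases of both matroids that contain as many
elements of each superlevel set of `c` as the rank allows, so that summation by parts reduces
the claim to the inequality
`z(F) ≤ lam * gaoRank F + (s - lam) * rk F` for all edge sets `F` (`IsLayered.rank_inequality`).

That inequality follows from `z(F) ≤ s * rk F` if `rk F ≤ gaoRank F`. Otherwise one of four changes
of `F` decreases `rk F - gaoRank F`, and the inequality for the new set implies the one for `F`.
* If a component of `(V, F)` contains two components of one level, the level is filled. The edges
  inside a level carry at least its size minus two times `s`, plus `lam`.
* If a component meets two consecutive levels between which `F` has no edge, both levels are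
  filled.
* If a component jumps over a level, all edges that jump over that level are deleted; their value
  is at most `s - lam`.
* If two components cross one cut of the chain, the edges of the cut are deleted; this lowers
  the rank by at least two, and their value is at most `2 * s - lam`.
If none of these changes is possible, the components of `(V, F)` are paths of level components,
with at most one edge between any two consecutive levels, whence `rk F ≤ gaoRank F`.

Ranks are dimensions of spans over `𝔽₂`, where the edge `uv` is the vector `χ_u + χ_v`.
Connectivity in `(V, F)` is membership of `χ_u + χ_v` in the span of `F`.

For subtour solutions the narrow cuts form a chain by uncrossing two of them into their differences,
which avoid `s` and `t`. In the layered combination, the layers up to the first one of size at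
most `2 - r` consist of trees that are Gao-trees for all cuts of size at most `2 - r`, and their
coefficients sum to at least `r`.
-/

namespace PathTSP

set_option linter.unusedSectionVars false

variable {V : Type*} [Fintype V] [DecidableEq V] {G : SimpleGraph V} [DecidableRel G.Adj]

/-! ### Edge sets and their values -/

theorem exists_eq_edge (e : G.edgeSet) : ∃ u v, ∃ h : G.Adj u v, e = ⟨s(u, v), h⟩ := by
  obtain ⟨e, he⟩ := e
  induction e using Sym2.ind with
  | _ u v => exact ⟨u, v, he, rfl⟩

theorem mem_edgesBetween {S T : Finset V} {u v : V} (h : G.Adj u v) :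
    (⟨s(u, v), h⟩ : G.edgeSet) ∈ edgesBetween G S T ↔ (u ∈ S ∧ v ∈ T) ∨ (v ∈ S ∧ u ∈ T) := by
  simp only [edgesBetween, Finset.mem_filter, Finset.mem_univ, true_and, Sym2.eq_iff]
  constructor
  · rintro ⟨i, hi, j, hj, ⟨rfl, rfl⟩ | ⟨rfl, rfl⟩⟩
    · exact Or.inl ⟨hi, hj⟩
    · exact Or.inr ⟨hi, hj⟩
  · rintro (⟨hi, hj⟩ | ⟨hi, hj⟩)
    · exact ⟨u, hi, v, hj, Or.inl ⟨rfl, rfl⟩⟩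
    · exact ⟨v, hi, u, hj, Or.inr ⟨rfl, rfl⟩⟩

theorem mem_edgesIn {S : Finset V} {u v : V} (h : G.Adj u v) :
    (⟨s(u, v), h⟩ : G.edgeSet) ∈ edgesIn G S ↔ u ∈ S ∧ v ∈ S := by
  rw [edgesIn, mem_edgesBetween]; tauto

theorem mem_cut {S : Finset V} {u v : V} (h : G.Adj u v) :
    (⟨s(u, v), h⟩ : G.edgeSet) ∈ cut G S ↔ (u ∈ S ∧ v ∉ S) ∨ (v ∈ S ∧ u ∉ S) := by
  rw [cut, mem_edgesBetween]; simp only [Finset.mem_compl]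

theorem edgesIn_univ : edgesIn G (Finset.univ : Finset V) = Finset.univ := by
  ext e
  obtain ⟨u, v, h, rfl⟩ := exists_eq_edge e
  simp [mem_edgesIn]

theorem total_eq_sum_ite {E : Type*} [Fintype E] [DecidableEq E] (x : E → ℝ) (F : Finset E) :
    total x F = ∑ e, if e ∈ F then x e else 0 := by
  rw [total, Finset.sum_ite_mem, Finset.univ_inter]

theorem total_mono {E : Type*} {x : E → ℝ} (hx : ∀ e, 0 ≤ x e) {F F' : Finset E} (h : F ⊆ F') :
    total x F ≤ total x F' :=
  Finset.sum_le_sum_of_subset_of_nonneg h fun _ _ _ => hx _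

theorem total_nonneg {E : Type*} {x : E → ℝ} (hx : ∀ e, 0 ≤ x e) (F : Finset E) :
    0 ≤ total x F :=
  Finset.sum_nonneg fun _ _ => hx _

theorem total_sub_smul {E : Type*} (x y : E → ℝ) (a : ℝ) (F : Finset E) :
    total (x - a • y) F = total x F - a * total y F := by
  simp [total, Finset.sum_sub_distrib, Finset.mul_sum]

theorem total_incidenceVector {E : Type*} [DecidableEq E] (T F : Finset E) :
    total (incidenceVector T) F = ((T ∩ F).card : ℝ) := by
  simp [total, incidenceVector, Finset.inter_comm]

theorem total_inter_add_sdiff {E : Type*} [DecidableEq E] (x : E → ℝ) (F X : Finset E) :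
    total x (F ∩ X) + total x (F \ X) = total x F := by
  rw [add_comm, total, total, total, ← Finset.sum_inter_add_sum_sdiff F X, add_comm]

theorem total_union_le {E : Type*} [DecidableEq E] {x : E → ℝ} (hx : ∀ e, 0 ≤ x e)
    (F X : Finset E) : total x (F ∪ X) ≤ total x F + total x X := by
  have h : total x (F ∪ X) + total x (F ∩ X) = total x F + total x X :=
    Finset.sum_union_inter
  have := total_nonneg hx (F ∩ X)
  linarith

/-! ### Counting edges by the position of their endpoints -/

theorem total_edgesIn_sdiff (x : G.edgeSet → ℝ) {A B : Finset V} (h : A ⊆ B) :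
    total x (edgesIn G (B \ A)) = total x (edgesIn G B) - total x (edgesIn G A)
      - total x (cut G A) + total x (edgesBetween G A Bᶜ) := by
  have key : total x (edgesIn G (B \ A)) + total x (edgesIn G A) + total x (cut G A) =
      total x (edgesIn G B) + total x (edgesBetween G A Bᶜ) := by
    simp only [total_eq_sum_ite, ← Finset.sum_add_distrib]
    refine Finset.sum_congr rfl fun e _ => ?_
    obtain ⟨u, v, he, rfl⟩ := exists_eq_edge e
    simp only [mem_edgesIn, mem_cut, mem_edgesBetween, Finset.mem_sdiff, Finset.mem_compl]
    have hu := @h u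
    have hv := @h v
    by_cases h1 : u ∈ A <;> by_cases h2 : v ∈ A <;> by_cases h3 : u ∈ B <;>
      by_cases h4 : v ∈ B <;> simp_all
  linarith

/-- The handshake identity for a vertex set. -/
theorem sum_total_cut_singleton (x : G.edgeSet → ℝ) (A : Finset V) :
    ∑ v ∈ A, total x (cut G {v}) = 2 * total x (edgesIn G A) + total x (cut G A) := by
  simp only [total_eq_sum_ite]
  rw [Finset.sum_comm, Finset.mul_sum, ← Finset.sum_add_distrib]
  refine Finset.sum_congr rfl fun e _ => ?_
  obtain ⟨u, v, he, rfl⟩ := exists_eq_edge e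
  have hne : u ≠ v := he.ne
  have h1 : ∀ w ∈ A, (if (⟨s(u, v), he⟩ : G.edgeSet) ∈ cut G {w} then x ⟨s(u, v), he⟩ else 0) =
      (if u = w then x ⟨s(u, v), he⟩ else 0) + (if v = w then x ⟨s(u, v), he⟩ else 0) := by
    intro w _
    simp only [mem_cut, Finset.mem_singleton]
    by_cases h1 : u = w
    · subst h1; simp [hne.symm]
    · by_cases h2 : v = w
      · subst h2; simp [hne]
      · simp [h1, h2]
  rw [Finset.sum_congr rfl h1, Finset.sum_add_distrib, Finset.sum_ite_eq, Finset.sum_ite_eq]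
  simp only [mem_edgesIn, mem_cut]
  by_cases h1 : u ∈ A <;> by_cases h2 : v ∈ A <;> simp [h1, h2]
  ring

theorem cut_compl (A : Finset V) : cut G Aᶜ = cut G A := by
  ext e
  obtain ⟨u, v, he, rfl⟩ := exists_eq_edge e
  simp only [mem_cut, Finset.mem_compl]
  tauto

/-- Uncrossing of two cuts by the two set differences. -/
theorem total_cut_sdiff_add_le {x : G.edgeSet → ℝ} (hx : ∀ e, 0 ≤ x e) (A B : Finset V) :
    total x (cut G (A \ B)) + total x (cut G (B \ A)) ≤
      total x (cut G A) + total x (cut G B) := by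
  simp only [total_eq_sum_ite, ← Finset.sum_add_distrib]
  refine Finset.sum_le_sum fun e _ => ?_
  have hx' := hx e
  obtain ⟨u, v, he, rfl⟩ := exists_eq_edge e
  simp only [mem_cut, Finset.mem_sdiff]
  by_cases h1 : u ∈ A <;> by_cases h2 : v ∈ A <;> by_cases h3 : u ∈ B <;>
    by_cases h4 : v ∈ B <;> simp [h1, h2, h3, h4, hx']

/-! ### The scaled spanning tree polytope -/

/-- The dilation `s · Sp(G)` of the spanning tree polytope, given by its inequalities. For `s = 0`
it consists of the origin only. -/
def scaledPolytope (G : SimpleGraph V) [DecidableRel G.Adj] (s : ℝ) : Set (G.edgeSet → ℝ) :=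
  {x | (∀ e, 0 ≤ x e) ∧
    (∀ U : Finset V, U.Nonempty → total x (edgesIn G U) ≤ s * ((U.card : ℝ) - 1)) ∧
    total x Finset.univ = s * ((Fintype.card V : ℝ) - 1)}

theorem mem_scaledPolytope_one {x : G.edgeSet → ℝ} :
    x ∈ scaledPolytope G 1 ↔ x ∈ spanningTreePolytope G := by
  simp [scaledPolytope, spanningTreePolytope]

/-- If no edge of `F` leaves the two parts into which `D` splits `M`, then the bound `s * (|M| - 1)`
for `F` improves by `s`. -/
theorem total_le_of_no_edge_between {s : ℝ} {z : G.edgeSet → ℝ} (hz : z ∈ scaledPolytope G s)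
    {M D : Finset V} (h1 : (M ∩ D).Nonempty) (h2 : (M \ D).Nonempty) {F : Finset G.edgeSet}
    (hF : F ⊆ edgesIn G (M ∩ D) ∪ edgesIn G (M \ D)) :
    total z F ≤ s * ((M.card : ℝ) - 2) := by
  have h3 := total_mono hz.1 hF
  have h4 := total_union_le hz.1 (edgesIn G (M ∩ D)) (edgesIn G (M \ D))
  have h5 := hz.2.1 _ h1
  have h6 := hz.2.1 _ h2
  have h7 : ((M ∩ D).card : ℝ) + ((M \ D).card : ℝ) = M.card := by
    exact_mod_cast Finset.card_inter_add_card_sdiff M D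
  rw [← h7]
  linarith [mul_add s ((M ∩ D).card : ℝ) ((M \ D).card : ℝ)]

/-! ### The graphic matroid over the field with two elements -/

/-- The vector `χ_u + χ_v` over `𝔽₂` that represents the edge `uv` in the graphic matroid. -/
def edgeVec : Sym2 V → V → ZMod 2 :=
  Sym2.lift ⟨fun u v => Pi.single u 1 + Pi.single v 1, fun _ _ => add_comm _ _⟩

@[simp] theorem edgeVec_mk (u v : V) :
    edgeVec s(u, v) = (Pi.single u 1 + Pi.single v 1 : V → ZMod 2) := rfl

theorem edgeVec_self (u : V) : edgeVec s(u, u) = 0 := by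
  ext w
  simpa using CharTwo.add_self_eq_zero (Pi.single (M := fun _ => ZMod 2) u 1 w)

theorem edgeVec_add (u v w : V) : edgeVec s(u, v) + edgeVec s(v, w) = edgeVec s(u, w) := by
  have : (Pi.single v 1 : V → ZMod 2) + Pi.single v 1 = 0 := edgeVec_self v
  simp only [edgeVec_mk]
  calc _ = (Pi.single u 1 : V → ZMod 2) + (Pi.single v 1 + Pi.single v 1) + Pi.single w 1 := by abel
    _ = _ := by rw [this, add_zero]

/-- The span of an edge set in the graphic matroid. -/
def edgeSpan (F : Finset G.edgeSet) : Submodule (ZMod 2) (V → ZMod 2) :=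
  Submodule.span (ZMod 2) ((fun e : G.edgeSet => edgeVec (e : Sym2 V)) '' F)

/-- The rank of an edge set in the graphic matroid. -/
noncomputable def rk (F : Finset G.edgeSet) : ℕ := Module.finrank (ZMod 2) (edgeSpan F)

/-- `u` and `v` lie in the same connected component of `(V, F)`, expressed through the span
of `F`. -/
def Linked (F : Finset G.edgeSet) (u v : V) : Prop := edgeVec s(u, v) ∈ edgeSpan F

theorem edgeSpan_mono {F F' : Finset G.edgeSet} (h : F ⊆ F') : edgeSpan F ≤ edgeSpan F' :=
  Submodule.span_mono (Set.image_mono h)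

theorem edgeSpan_union (F F' : Finset G.edgeSet) :
    edgeSpan (F ∪ F') = edgeSpan F ⊔ edgeSpan F' := by
  rw [edgeSpan, Finset.coe_union, Set.image_union, Submodule.span_union]; rfl

theorem edgeSpan_le_iff {F : Finset G.edgeSet} {W : Submodule (ZMod 2) (V → ZMod 2)} :
    edgeSpan F ≤ W ↔ ∀ e ∈ F, edgeVec (e : Sym2 V) ∈ W := by
  rw [edgeSpan, Submodule.span_le, Set.image_subset_iff]; rfl

theorem edgeVec_mem {F : Finset G.edgeSet} {e : G.edgeSet} (he : e ∈ F) :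
    edgeVec (e : Sym2 V) ∈ edgeSpan F :=
  edgeSpan_le_iff.1 le_rfl e he

theorem Linked.refl (F : Finset G.edgeSet) (u : V) : Linked F u u := by
  rw [Linked, edgeVec_self]; exact zero_mem _

theorem Linked.symm {F : Finset G.edgeSet} {u v : V} (h : Linked F u v) : Linked F v u := by
  rwa [Linked, Sym2.eq_swap]

theorem Linked.trans {F : Finset G.edgeSet} {u v w : V} (h : Linked F u v) (h' : Linked F v w) :
    Linked F u w := by
  rw [Linked, ← edgeVec_add u v w]; exact add_mem h h'

theorem Linked.mono {F F' : Finset G.edgeSet} (hF : F ⊆ F') {u v : V} (h : Linked F u v) :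
    Linked F' u v :=
  edgeSpan_mono hF h

theorem linked_of_mem {F : Finset G.edgeSet} {u v : V} (h : G.Adj u v)
    (he : (⟨s(u, v), h⟩ : G.edgeSet) ∈ F) : Linked F u v :=
  edgeVec_mem he

theorem rk_mono {F F' : Finset G.edgeSet} (h : F ⊆ F') : rk F ≤ rk F' :=
  Submodule.finrank_mono (edgeSpan_mono h)

/-- Diminishing returns for the rank function. -/
theorem rk_union_add_le {A B X : Finset G.edgeSet} (h : A ⊆ B) :
    rk (B ∪ X) + rk A ≤ rk (A ∪ X) + rk B := by
  have h1 := Submodule.finrank_sup_add_finrank_inf_eq (edgeSpan B) (edgeSpan (A ∪ X))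
  have h2 : edgeSpan B ⊔ edgeSpan (A ∪ X) = edgeSpan (B ∪ X) := by
    rw [edgeSpan_union, edgeSpan_union, ← sup_assoc, sup_eq_left.2 (edgeSpan_mono h)]
  have h3 : Module.finrank (ZMod 2) (edgeSpan A) ≤
      Module.finrank (ZMod 2) (edgeSpan B ⊓ edgeSpan (A ∪ X) : Submodule (ZMod 2) (V → ZMod 2)) :=
    Submodule.finrank_mono (le_inf (edgeSpan_mono h) (edgeSpan_mono Finset.subset_union_left))
  rw [h2] at h1
  unfold rk
  omega

/-- The functional that sums the coordinates over `D`. -/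
def sumOn (D : Finset V) : (V → ZMod 2) →ₗ[ZMod 2] ZMod 2 := ∑ v ∈ D, LinearMap.proj v

theorem sumOn_edgeVec (D : Finset V) (u v : V) :
    sumOn D (edgeVec s(u, v)) = (if u ∈ D then 1 else 0) + (if v ∈ D then 1 else 0) := by
  simp [sumOn, LinearMap.sum_apply, Pi.single_apply, Finset.sum_add_distrib]

theorem sumOn_edgeVec_eq_zero {D : Finset V} {u v : V} :
    sumOn D (edgeVec s(u, v)) = 0 ↔ (u ∈ D ↔ v ∈ D) := by
  rw [sumOn_edgeVec]
  by_cases h1 : u ∈ D <;> by_cases h2 : v ∈ D <;> simp [h1, h2]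
  decide

theorem edgeSpan_le_ker_sumOn {F : Finset G.edgeSet} {D : Finset V}
    (h : ∀ u v, ∀ he : G.Adj u v, (⟨s(u, v), he⟩ : G.edgeSet) ∈ F → u ∈ D → v ∈ D) :
    edgeSpan F ≤ LinearMap.ker (sumOn D) := by
  rw [edgeSpan_le_iff]
  intro e he
  obtain ⟨u, v, hadj, rfl⟩ := exists_eq_edge e
  rw [LinearMap.mem_ker, sumOn_edgeVec_eq_zero]
  refine ⟨h u v hadj he, fun hv => h v u hadj.symm ?_ hv⟩
  rwa [show (⟨s(v, u), hadj.symm⟩ : G.edgeSet) = ⟨s(u, v), hadj⟩ from Subtype.ext Sym2.eq_swap]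

/-- An edge set without edges between `D` and its complement links no vertex of `D` to one
outside `D`. -/
theorem Linked.mem_of_closed {F : Finset G.edgeSet} {D : Finset V}
    (h : ∀ u v, ∀ he : G.Adj u v, (⟨s(u, v), he⟩ : G.edgeSet) ∈ F → u ∈ D → v ∈ D)
    {u v : V} (huv : Linked F u v) (hu : u ∈ D) : v ∈ D :=
  (sumOn_edgeVec_eq_zero.1 (LinearMap.mem_ker.1 (edgeSpan_le_ker_sumOn h huv))).1 hu

/-- Strictly diminishing returns, witnessed by a vector `a`. -/
theorem rk_union_add_lt {A B X : Finset G.edgeSet} (h : A ⊆ B) {a : V → ZMod 2}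
    (h1 : a ∈ edgeSpan B) (h2 : a ∈ edgeSpan (A ∪ X)) (h3 : a ∉ edgeSpan A) :
    rk (B ∪ X) + rk A < rk (A ∪ X) + rk B := by
  have h4 := Submodule.finrank_sup_add_finrank_inf_eq (edgeSpan B) (edgeSpan (A ∪ X))
  have h5 : edgeSpan B ⊔ edgeSpan (A ∪ X) = edgeSpan (B ∪ X) := by
    rw [edgeSpan_union, edgeSpan_union, ← sup_assoc, sup_eq_left.2 (edgeSpan_mono h)]
  have h6 : Module.finrank (ZMod 2) (edgeSpan A) <
      Module.finrank (ZMod 2) (edgeSpan B ⊓ edgeSpan (A ∪ X) : Submodule (ZMod 2) (V → ZMod 2)) :=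
    Submodule.finrank_lt_finrank_of_lt (lt_of_le_of_ne
      (le_inf (edgeSpan_mono h) (edgeSpan_mono Finset.subset_union_left))
      fun h' => h3 (h' ▸ Submodule.mem_inf.2 ⟨h1, h2⟩))
  rw [h5] at h4
  unfold rk
  omega

open Classical in
/-- The connected component of `u` in `(V, F)`. -/
noncomputable def component (F : Finset G.edgeSet) (u : V) : Finset V :=
  Finset.univ.filter fun v => Linked F u v

theorem mem_component {F : Finset G.edgeSet} {u v : V} : v ∈ component F u ↔ Linked F u v := by
  simp [component]

theorem component_closed {F : Finset G.edgeSet} (w : V) (u v : V) (he : G.Adj u v)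
    (hF : (⟨s(u, v), he⟩ : G.edgeSet) ∈ F) (hu : u ∈ component F w) : v ∈ component F w :=
  mem_component.2 ((mem_component.1 hu).trans (linked_of_mem he hF))

/-- An edge set whose edges join vertices with equal labels has rank at most `|V|` minus the
number of labels. -/
theorem rk_add_card_le {ι : Type*} [Fintype ι] [DecidableEq ι] (f : V → ι)
    (hf : Function.Surjective f) {F : Finset G.edgeSet}
    (h : ∀ u v, ∀ he : G.Adj u v, (⟨s(u, v), he⟩ : G.edgeSet) ∈ F → f u = f v) :
    rk F + Fintype.card ι ≤ Fintype.card V := by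
  let φ : (V → ZMod 2) →ₗ[ZMod 2] (ι → ZMod 2) :=
    LinearMap.pi fun i => sumOn (Finset.univ.filter fun v => f v = i)
  have hle : edgeSpan F ≤ LinearMap.ker φ := by
    intro y hy
    rw [LinearMap.mem_ker]
    ext i
    refine LinearMap.mem_ker.1 (edgeSpan_le_ker_sumOn ?_ hy)
    intro u v he heF hu
    simp only [Finset.mem_filter, Finset.mem_univ, true_and] at hu ⊢
    rw [← h u v he heF, hu]
  have hsurj : Function.Surjective φ := by
    intro y
    choose g hg using hf
    refine ⟨∑ i, y i • Pi.single (g i) 1, ?_⟩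
    ext j
    simp only [φ, sumOn, LinearMap.pi_apply, LinearMap.sum_apply, LinearMap.proj_apply,
      Finset.sum_apply, Pi.smul_apply, smul_eq_mul]
    rw [Finset.sum_comm]
    rw [Finset.sum_eq_single j]
    · rw [Finset.sum_eq_single (g j)] <;> simp +contextual [hg]
    · intro i _ hij
      refine Finset.sum_eq_zero fun v hv => ?_
      simp only [Finset.mem_filter, Finset.mem_univ, true_and] at hv
      rw [Pi.single_apply, if_neg, mul_zero]
      rintro rfl
      exact hij ((hg i).symm.trans hv)
    · simp
  have h1 := φ.finrank_range_add_finrank_ker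
  rw [LinearMap.range_eq_top.2 hsurj, finrank_top, Module.finrank_fintype_fun_eq_card,
    Module.finrank_fintype_fun_eq_card] at h1
  have h2 : rk F ≤ _ := Submodule.finrank_mono hle
  omega

theorem rk_edgesIn_add_one_le {U : Finset V} (hU : U.Nonempty) {F : Finset G.edgeSet}
    (hF : F ⊆ edgesIn G U) : rk F + 1 ≤ U.card := by
  -- contract `U` to the label `none`
  let f : V → Option {v // v ∉ U} := fun v => if h : v ∈ U then none else some ⟨v, h⟩
  have hf : Function.Surjective f := by
    rintro (_ | ⟨v, hv⟩)
    · obtain ⟨u, hu⟩ := hU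
      exact ⟨u, by simp [f, hu]⟩
    · exact ⟨v, by simp [f, hv]⟩
  have h1 := rk_add_card_le (F := F) f hf (by
    intro u v he heF
    have := (mem_edgesIn he).1 (hF heF)
    simp [f, this.1, this.2])
  have h2 : Fintype.card {v // v ∉ U} = Fintype.card V - U.card := by
    rw [Fintype.card_subtype_compl]; simp
  have h3 := Finset.card_le_univ U
  rw [Fintype.card_option, h2] at h1
  omega

/-- The rank bounds the value of an edge set for every point of the polytope. -/
theorem total_le_rk {s : ℝ} (hs : 0 ≤ s) {z : G.edgeSet → ℝ} (hz : z ∈ scaledPolytope G s)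
    (F : Finset G.edgeSet) : total z F ≤ s * rk F := by
  classical
  -- the components of `(V, F)`
  let P : Finset (Finset V) := Finset.univ.image (component F)
  have hmem : ∀ u, u ∈ component F u := fun u => mem_component.2 (Linked.refl F u)
  have heq : ∀ {u v}, v ∈ component F u → component F v = component F u := by
    intro u v h
    ext w
    rw [mem_component] at h
    rw [mem_component, mem_component]
    exact ⟨h.trans, h.symm.trans⟩
  have hcard : ∑ U ∈ P, (U.card : ℝ) = Fintype.card V := by
    have hdisj : Set.PairwiseDisjoint (P : Set (Finset V)) id := by
      intro A hA B hB hAB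
      simp only [P, Finset.coe_image, Finset.coe_univ, Set.image_univ, Set.mem_range] at hA hB
      obtain ⟨a, rfl⟩ := hA
      obtain ⟨b, rfl⟩ := hB
      refine Finset.disjoint_left.2 fun w h1 h2 => hAB ?_
      rw [← heq h1, ← heq h2]
    have h1 : P.biUnion id = Finset.univ := by
      ext v
      simp only [Finset.mem_biUnion, Finset.mem_univ, iff_true, id]
      exact ⟨component F v, Finset.mem_image_of_mem _ (Finset.mem_univ v), hmem v⟩
    have h2 := Finset.card_biUnion hdisj
    rw [h1, Finset.card_univ] at h2
    exact_mod_cast h2.symm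
  have hrk : Fintype.card V ≤ rk F + P.card := by
    rcases isEmpty_or_nonempty V with hV | hV
    · simp
    -- one representative of each component spans the whole space together with `F`
    have hrep : ∀ U ∈ P, ∃ u, component F u = U := by
      intro U hU
      obtain ⟨u, _, rfl⟩ := Finset.mem_image.1 hU
      exact ⟨u, rfl⟩
    choose! g hg using hrep
    let R : Finset (V → ZMod 2) := P.image fun U => Pi.single (g U) 1
    have htop : edgeSpan F ⊔ Submodule.span (ZMod 2) (R : Set (V → ZMod 2)) = ⊤ := by
      rw [eq_top_iff, ← Pi.basisFun (ZMod 2) V |>.span_eq, Submodule.span_le]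
      rintro _ ⟨v, rfl⟩
      rw [Pi.basisFun_apply]
      have hv : component F v ∈ P := Finset.mem_image_of_mem _ (Finset.mem_univ v)
      have h1 : Linked F v (g (component F v)) := by
        have := hmem (g (component F v))
        rwa [hg _ hv, mem_component] at this
      have h2 : (Pi.single v 1 : V → ZMod 2) =
          edgeVec s(v, g (component F v)) + Pi.single (g (component F v)) 1 := by
        have : (Pi.single (g (component F v)) 1 : V → ZMod 2) +
          Pi.single (g (component F v)) 1 = 0 := edgeVec_self _
        rw [edgeVec_mk, add_assoc, this, add_zero]
      rw [h2]
      exact Submodule.add_mem_sup h1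
        (Submodule.subset_span (Finset.mem_coe.2 (Finset.mem_image_of_mem _ hv)))
    have h1 := Submodule.finrank_add_le_finrank_add_finrank (edgeSpan F)
      (Submodule.span (ZMod 2) (R : Set (V → ZMod 2)))
    rw [htop, finrank_top, Module.finrank_fintype_fun_eq_card] at h1
    have h2 : Module.finrank (ZMod 2) (Submodule.span (ZMod 2) (R : Set (V → ZMod 2))) ≤ R.card :=
      finrank_span_finset_le_card R
    have h3 : R.card ≤ P.card := Finset.card_image_le
    unfold rk
    omega
  have hsub : F ⊆ P.biUnion fun U => edgesIn G U := by
    intro e he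
    obtain ⟨u, v, hadj, rfl⟩ := exists_eq_edge e
    refine Finset.mem_biUnion.2 ⟨component F u,
      Finset.mem_image_of_mem _ (Finset.mem_univ u), (mem_edgesIn hadj).2 ⟨hmem u, ?_⟩⟩
    exact mem_component.2 (linked_of_mem hadj he)
  have hsum : total z (P.biUnion fun U => edgesIn G U) ≤ ∑ U ∈ P, total z (edgesIn G U) := by
    clear hcard hrk hsub
    induction P using Finset.induction_on with
    | empty => simp [total]
    | insert U P hU ih =>
      rw [Finset.biUnion_insert, Finset.sum_insert hU]
      exact (total_union_le hz.1 _ _).trans (by linarith)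
  calc total z F ≤ ∑ U ∈ P, total z (edgesIn G U) := (total_mono hz.1 hsub).trans hsum
    _ ≤ ∑ U ∈ P, s * ((U.card : ℝ) - 1) := by
      refine Finset.sum_le_sum fun U hU => hz.2.1 U ?_
      obtain ⟨u, _, rfl⟩ := Finset.mem_image.1 hU
      exact ⟨u, hmem u⟩
    _ = s * ((Fintype.card V : ℝ) - P.card) := by
      rw [← Finset.mul_sum, Finset.sum_sub_distrib, hcard]; simp
    _ ≤ s * rk F := by
      refine mul_le_mul_of_nonneg_left ?_ hs
      have : (Fintype.card V : ℝ) ≤ rk F + P.card := by exact_mod_cast hrk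
      linarith

/-! ### Layered points and the matroid of Gao-trees -/

/-- The vertices of level less than `i`. -/
def below (ℓ : V → ℕ) (i : ℕ) : Finset V := Finset.univ.filter fun v => ℓ v < i

/-- The vertices of level `i`. -/
def layer (ℓ : V → ℕ) (i : ℕ) : Finset V := Finset.univ.filter fun v => ℓ v = i

theorem mem_below {ℓ : V → ℕ} {i : ℕ} {v : V} : v ∈ below ℓ i ↔ ℓ v < i := by simp [below]

theorem mem_layer {ℓ : V → ℕ} {i : ℕ} {v : V} : v ∈ layer ℓ i ↔ ℓ v = i := by simp [layer]

theorem below_mono (ℓ : V → ℕ) {i j : ℕ} (h : i ≤ j) : below ℓ i ⊆ below ℓ j :=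
  fun _ hv => mem_below.2 ((mem_below.1 hv).trans_le h)

theorem mem_below_sdiff {ℓ : V → ℕ} {i j : ℕ} {v : V} :
    v ∈ below ℓ j \ below ℓ i ↔ i ≤ ℓ v ∧ ℓ v < j := by
  rw [Finset.mem_sdiff, mem_below, mem_below]; omega

theorem below_succ_sdiff (ℓ : V → ℕ) (i : ℕ) : below ℓ (i + 1) \ below ℓ i = layer ℓ i := by
  ext v
  rw [mem_below_sdiff, mem_layer]; omega

/-- The edges that stay within one level. -/
def levelEdges (G : SimpleGraph V) [DecidableRel G.Adj] (ℓ : V → ℕ) : Finset G.edgeSet :=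
  Finset.univ.filter fun e => ∃ u v, ℓ u = ℓ v ∧ (e : Sym2 V) = s(u, v)

/-- The edges between the consecutive levels `i` and `i + 1`. -/
def linkEdges (G : SimpleGraph V) [DecidableRel G.Adj] (ℓ : V → ℕ) (i : ℕ) :
    Finset G.edgeSet :=
  edgesBetween G (layer ℓ i) (layer ℓ (i + 1))

/-- The edges that jump over the level `i`. -/
def jumpEdges (G : SimpleGraph V) [DecidableRel G.Adj] (ℓ : V → ℕ) (i : ℕ) :
    Finset G.edgeSet :=
  edgesBetween G (below ℓ i) (below ℓ (i + 1))ᶜ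

theorem mem_levelEdges {ℓ : V → ℕ} {u v : V} (h : G.Adj u v) :
    (⟨s(u, v), h⟩ : G.edgeSet) ∈ levelEdges G ℓ ↔ ℓ u = ℓ v := by
  simp only [levelEdges, Finset.mem_filter, Finset.mem_univ, true_and, Sym2.eq_iff]
  constructor
  · rintro ⟨a, b, hab, ⟨rfl, rfl⟩ | ⟨rfl, rfl⟩⟩
    exacts [hab, hab.symm]
  · exact fun h' => ⟨u, v, h', Or.inl ⟨rfl, rfl⟩⟩

theorem mem_linkEdges {ℓ : V → ℕ} {i : ℕ} {u v : V} (h : G.Adj u v) :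
    (⟨s(u, v), h⟩ : G.edgeSet) ∈ linkEdges G ℓ i ↔
      (ℓ u = i ∧ ℓ v = i + 1) ∨ (ℓ v = i ∧ ℓ u = i + 1) := by
  simp only [linkEdges, mem_edgesBetween, mem_layer]

theorem mem_jumpEdges {ℓ : V → ℕ} {i : ℕ} {u v : V} (h : G.Adj u v) :
    (⟨s(u, v), h⟩ : G.edgeSet) ∈ jumpEdges G ℓ i ↔
      (ℓ u < i ∧ i < ℓ v) ∨ (ℓ v < i ∧ i < ℓ u) := by
  simp only [jumpEdges, mem_edgesBetween, mem_below, Finset.mem_compl]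
  omega

/-- The indices `i < n` for which `F` contains an edge between the levels `i` and `i + 1`. -/
def linkSet (ℓ : V → ℕ) (n : ℕ) (F : Finset G.edgeSet) : Finset ℕ :=
  (Finset.range n).filter fun i => (F ∩ linkEdges G ℓ i).Nonempty

theorem mem_linkSet {ℓ : V → ℕ} {n : ℕ} {F : Finset G.edgeSet} {i : ℕ} :
    i ∈ linkSet ℓ n F ↔ i < n ∧ ∃ e ∈ F, e ∈ linkEdges G ℓ i := by
  simp [linkSet, Finset.Nonempty]

/-- The rank of `F` in the matroid whose bases are the Gao-trees for the sets `below ℓ i`,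
`1 ≤ i ≤ n`: the direct sum of the graphic matroids of the levels and of the uniform matroids of
rank one on the edges between consecutive levels. Edges that jump over a level are loops. -/
noncomputable def gaoRank (ℓ : V → ℕ) (n : ℕ) (F : Finset G.edgeSet) : ℕ :=
  rk (F ∩ levelEdges G ℓ) + (linkSet ℓ n F).card

/-- A point `z` of `s · Sp(G)` that satisfies, for the chain of the sets `below ℓ i`, `1 ≤ i ≤ n`,
the scaled conditions of a chain-point; every cut of the chain falls below `2 * s` by at least `lam`.
No cut is required to have value `s`. The degree condition is given as a condition on each set of the chain:
its degree sum is `2 * s` times its size, minus `s`. -/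
structure IsLayered (G : SimpleGraph V) [DecidableRel G.Adj] (z : G.edgeSet → ℝ) (s lam : ℝ)
    (n : ℕ) (ℓ : V → ℕ) : Prop where
  pos : 0 < lam
  le : lam ≤ s
  exists_level : ∀ i ≤ n, ∃ v, ℓ v = i
  level_le : ∀ v, ℓ v ≤ n
  mem : z ∈ scaledPolytope G s
  cut_le : ∀ i, 1 ≤ i → i ≤ n → total z (cut G (below ℓ i)) ≤ 2 * s - lam
  degree : ∀ i, 1 ≤ i → i ≤ n →
    2 * total z (edgesIn G (below ℓ i)) + total z (cut G (below ℓ i)) =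
      s * (2 * ((below ℓ i).card : ℝ) - 1)

namespace IsLayered

variable {z : G.edgeSet → ℝ} {s lam : ℝ} {n : ℕ} {ℓ : V → ℕ}

/-- The edges inside a union of consecutive levels carry almost the largest possible value. -/
theorem le_total_edgesIn (h : IsLayered G z s lam n ℓ) {a b : ℕ} (hab : a ≤ b) (hb : b ≤ n + 1) :
    s * ((below ℓ b \ below ℓ a).card : ℝ) - 2 * s + lam +
      total z (edgesBetween G (below ℓ a) (below ℓ b)ᶜ) ≤
        total z (edgesIn G (below ℓ b \ below ℓ a)) := by
  have hpos := h.pos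
  have hle := h.le
  -- the sets `∅` and `V` are not in the chain, but satisfy the same two inequalities
  have hB : s * ((below ℓ b).card : ℝ) - 3 / 2 * s + lam / 2 ≤ total z (edgesIn G (below ℓ b)) := by
    rcases Nat.lt_or_ge n b with hn | hn
    · have : below ℓ b = Finset.univ := by
        ext v
        simpa [mem_below] using (h.level_le v).trans_lt hn
      rw [this, edgesIn_univ, h.mem.2.2, Finset.card_univ]
      linarith
    · rcases Nat.eq_zero_or_pos b with rfl | h0
      · have h1 : below ℓ 0 = ∅ := by ext v; simp [mem_below]
        have := total_nonneg h.mem.1 (edgesIn G (below ℓ 0))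
        rw [h1] at this ⊢
        simp only [Finset.card_empty, Nat.cast_zero]
        linarith
      · have h1 := h.degree b h0 hn
        have h2 := h.cut_le b h0 hn
        linarith
  have hA : total z (edgesIn G (below ℓ a)) + total z (cut G (below ℓ a)) ≤
      s * ((below ℓ a).card : ℝ) + s / 2 - lam / 2 := by
    rcases Nat.lt_or_ge n a with hn | hn
    · have : below ℓ a = Finset.univ := by
        ext v
        simpa [mem_below] using (h.level_le v).trans_lt hn
      have h2 : cut G (Finset.univ : Finset V) = ∅ := by
        ext e
        obtain ⟨u, v, he, rfl⟩ := exists_eq_edge e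
        simp [mem_cut]
      rw [this, edgesIn_univ, h.mem.2.2, Finset.card_univ, h2]
      simp only [total, Finset.sum_empty]
      linarith
    · rcases Nat.eq_zero_or_pos a with rfl | h0
      · have h1 : below ℓ 0 = ∅ := by ext v; simp [mem_below]
        have h2 : cut G (∅ : Finset V) = ∅ := by
          ext e
          obtain ⟨u, v, he, rfl⟩ := exists_eq_edge e
          simp [mem_cut]
        have h3 : edgesIn G (∅ : Finset V) = ∅ := by
          ext e
          obtain ⟨u, v, he, rfl⟩ := exists_eq_edge e
          simp [mem_edgesIn]
        rw [h1, h2, h3]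
        simp only [total, Finset.sum_empty, Finset.card_empty, Nat.cast_zero]
        linarith
      · have h1 := h.degree a h0 hn
        have h2 := h.cut_le a h0 hn
        linarith
  have hcard : ((below ℓ b \ below ℓ a).card : ℝ) = (below ℓ b).card - (below ℓ a).card := by
    rw [Finset.card_sdiff_of_subset (below_mono ℓ hab),
      Nat.cast_sub (Finset.card_le_card (below_mono ℓ hab))]
  rw [total_edgesIn_sdiff z (below_mono ℓ hab), hcard]
  linarith

/-- The value of the edges that jump over a level is at most `s - lam`. -/
theorem total_jumpEdges_le (h : IsLayered G z s lam n ℓ) {i : ℕ} (hi : i ≤ n) :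
    total z (jumpEdges G ℓ i) ≤ s - lam := by
  have h1 := h.le_total_edgesIn (Nat.le_succ i) (Nat.succ_le_succ hi)
  rw [Nat.succ_eq_add_one, below_succ_sdiff] at h1
  obtain ⟨v, hv⟩ := h.exists_level i hi
  have h2 := h.mem.2.1 (layer ℓ i) ⟨v, mem_layer.2 hv⟩
  rw [jumpEdges]
  linarith

/-- A union of consecutive levels does not split into two nonempty parts without an edge of `G`
between them. -/
theorem not_subset_union (h : IsLayered G z s lam n ℓ) {a b : ℕ} (hab : a ≤ b) (hb : b ≤ n + 1)
    {D : Finset V} (h1 : ((below ℓ b \ below ℓ a) ∩ D).Nonempty)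
    (h2 : ((below ℓ b \ below ℓ a) \ D).Nonempty) :
    ¬ edgesIn G (below ℓ b \ below ℓ a) ⊆
      edgesIn G ((below ℓ b \ below ℓ a) ∩ D) ∪ edgesIn G ((below ℓ b \ below ℓ a) \ D) := by
  intro hsub
  have h3 := total_le_of_no_edge_between h.mem h1 h2 hsub
  have h4 := h.le_total_edgesIn hab hb
  have h5 := total_nonneg h.mem.1 (edgesBetween G (below ℓ a) (below ℓ b)ᶜ)
  have := h.pos
  linarith

/-- Each level induces a connected subgraph. -/
theorem linked_layer (h : IsLayered G z s lam n ℓ) {u v : V} (huv : ℓ u = ℓ v) :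
    Linked (edgesIn G (layer ℓ (ℓ u))) u v := by
  by_contra hcon
  rw [← below_succ_sdiff] at hcon
  have hle := h.level_le u
  refine h.not_subset_union (Nat.le_succ (ℓ u)) (Nat.succ_le_succ hle)
    (D := component (edgesIn G (below ℓ (ℓ u + 1) \ below ℓ (ℓ u))) u)
    ⟨u, ?_⟩ ⟨v, ?_⟩ ?_
  · rw [Finset.mem_inter, mem_below_sdiff, mem_component]
    exact ⟨⟨le_rfl, Nat.lt_succ_self _⟩, Linked.refl _ _⟩
  · rw [Finset.mem_sdiff, mem_below_sdiff, mem_component]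
    exact ⟨⟨huv.le, by omega⟩, hcon⟩
  · intro e he
    obtain ⟨p, q, hpq, rfl⟩ := exists_eq_edge e
    have h1 := linked_of_mem hpq he
    rw [Nat.succ_eq_add_one, mem_edgesIn] at he
    rw [Nat.succ_eq_add_one, Finset.mem_union, mem_edgesIn, mem_edgesIn, Finset.mem_inter,
      Finset.mem_inter, Finset.mem_sdiff (a := p) (t := component _ _),
      Finset.mem_sdiff (a := q) (t := component _ _), mem_component, mem_component]
    by_cases hp : Linked (edgesIn G (below ℓ (ℓ u + 1) \ below ℓ (ℓ u))) u p
    · exact Or.inl ⟨⟨he.1, hp⟩, he.2, hp.trans h1⟩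
    · exact Or.inr ⟨⟨he.1, hp⟩, he.2, fun hq => hp (hq.trans h1.symm)⟩

/-- Consecutive levels are joined by an edge. -/
theorem exists_linkEdge (h : IsLayered G z s lam n ℓ) {i : ℕ} (hi : i < n) :
    (linkEdges G ℓ i).Nonempty := by
  by_contra hcon
  rw [Finset.not_nonempty_iff_eq_empty] at hcon
  obtain ⟨u, hu⟩ := h.exists_level i hi.le
  obtain ⟨v, hv⟩ := h.exists_level (i + 1) hi
  refine h.not_subset_union (a := i) (b := i + 2) (by omega) (by omega) (D := layer ℓ i)
    ⟨u, ?_⟩ ⟨v, ?_⟩ ?_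
  · rw [Finset.mem_inter, mem_below_sdiff, mem_layer]; omega
  · rw [Finset.mem_sdiff, mem_below_sdiff, mem_layer]; omega
  · intro e he
    obtain ⟨p, q, hpq, rfl⟩ := exists_eq_edge e
    have h1 : (⟨s(p, q), hpq⟩ : G.edgeSet) ∉ linkEdges G ℓ i := by rw [hcon]; simp
    rw [mem_edgesIn, mem_below_sdiff, mem_below_sdiff] at he
    rw [mem_linkEdges] at h1
    simp only [Finset.mem_union, mem_edgesIn, Finset.mem_inter,
      Finset.mem_sdiff (t := layer ℓ i), mem_below_sdiff, mem_layer]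
    omega

/-! ### The rank inequality -/

/-- The rank inequality passes from `F ∪ X` to `F` when `X` carries almost the largest value that
`m` vertices allow, and adding `X` raises the rank in the matroid of Gao-trees by more than the
graphic rank. -/
theorem rank_inequality_of_union (h : IsLayered G z s lam n ℓ) {F X : Finset G.edgeSet}
    {m : ℕ} (hX : s * (m : ℝ) - 2 * s + lam ≤ total z X)
    (h1 : gaoRank ℓ n (F ∪ X) + rk (F ∩ X) + 1 ≤ gaoRank ℓ n F + m)
    (h2 : rk (F ∪ X) + gaoRank ℓ n F + 1 ≤ rk F + gaoRank ℓ n (F ∪ X))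
    (h3 : total z (F ∪ X) ≤ lam * gaoRank ℓ n (F ∪ X) + (s - lam) * rk (F ∪ X)) :
    total z F ≤ lam * gaoRank ℓ n F + (s - lam) * rk F := by
  have hs : 0 ≤ s := h.pos.le.trans h.le
  have h4 : total z (F ∪ X) + total z (F ∩ X) = total z F + total z X := Finset.sum_union_inter
  have h5 := total_le_rk hs h.mem (F ∩ X)
  have h1' : (gaoRank ℓ n (F ∪ X) : ℝ) + rk (F ∩ X) + 1 ≤ gaoRank ℓ n F + m := by exact_mod_cast h1
  have h2' : (rk (F ∪ X) : ℝ) + gaoRank ℓ n F + 1 ≤ rk F + gaoRank ℓ n (F ∪ X) := by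
    exact_mod_cast h2
  have h6 := mul_le_mul_of_nonneg_left h1' hs
  have h7 := mul_le_mul_of_nonneg_left h2' (sub_nonneg.2 h.le)
  linarith

/-- Two vertices of one level that are linked in `F`, but not inside their level: fill the
level. -/
theorem rank_inequality_of_fill_layer (h : IsLayered G z s lam n ℓ) {F : Finset G.edgeSet}
    (ih : ∀ F', rk F' + gaoRank ℓ n F < rk F + gaoRank ℓ n F' →
      total z F' ≤ lam * gaoRank ℓ n F' + (s - lam) * rk F')
    {u v : V} (huv : ℓ u = ℓ v) (h1 : Linked F u v) (h2 : ¬ Linked (F ∩ levelEdges G ℓ) u v) :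
    total z F ≤ lam * gaoRank ℓ n F + (s - lam) * rk F := by
  set X := edgesIn G (layer ℓ (ℓ u)) with hXdef
  have hXlev : X ⊆ levelEdges G ℓ := by
    intro e
    obtain ⟨p, q, hpq, rfl⟩ := exists_eq_edge e
    rw [hXdef, mem_edgesIn, mem_layer, mem_layer, mem_levelEdges]
    omega
  have hlev : (F ∪ X) ∩ levelEdges G ℓ = F ∩ levelEdges G ℓ ∪ X := by
    rw [Finset.union_inter_distrib_right, Finset.inter_eq_left.2 hXlev]
  have hlink : linkSet ℓ n (F ∪ X) = linkSet ℓ n F := by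
    ext i
    simp only [mem_linkSet, Finset.mem_union]
    refine and_congr_right fun _ => exists_congr fun e => ?_
    obtain ⟨p, q, hpq, rfl⟩ := exists_eq_edge e
    rw [hXdef, mem_edgesIn, mem_layer, mem_layer, mem_linkEdges]
    constructor
    · rintro ⟨h1 | h1, h2⟩
      · exact ⟨h1, h2⟩
      · omega
    · exact fun h => ⟨Or.inl h.1, h.2⟩
  have hA : F ∩ X ⊆ F ∩ levelEdges G ℓ := Finset.inter_subset_inter_left hXlev
  have h3 := rk_union_add_le (X := X) hA
  rw [Finset.union_eq_right.2 Finset.inter_subset_right] at h3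
  have h4 : rk X + 1 ≤ (layer ℓ (ℓ u)).card :=
    rk_edgesIn_add_one_le ⟨u, mem_layer.2 rfl⟩ le_rfl
  have h5 := rk_union_add_lt (X := X) (Finset.inter_subset_left : F ∩ levelEdges G ℓ ⊆ F) h1
    ((h.linked_layer huv).mono Finset.subset_union_right) h2
  have h6 := h.le_total_edgesIn (Nat.le_succ (ℓ u)) (Nat.succ_le_succ (h.level_le u))
  have h7 := total_nonneg h.mem.1 (edgesBetween G (below ℓ (ℓ u)) (below ℓ (ℓ u + 1))ᶜ)
  rw [Nat.succ_eq_add_one, below_succ_sdiff] at h6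
  have h8 : gaoRank ℓ n (F ∪ X) = rk (F ∩ levelEdges G ℓ ∪ X) + (linkSet ℓ n F).card := by
    rw [gaoRank, hlev, hlink]
  have h9 : gaoRank ℓ n F = rk (F ∩ levelEdges G ℓ) + (linkSet ℓ n F).card := rfl
  refine h.rank_inequality_of_union (X := X) (m := (layer ℓ (ℓ u)).card) (by linarith) (by omega)
    (by omega) (ih _ (by omega))

/-- Vertices of consecutive levels that are linked in `F`, while `F` has no edge between these
levels: fill the union of the two levels. -/
theorem rank_inequality_of_fill_two_layers (h : IsLayered G z s lam n ℓ) {F : Finset G.edgeSet}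
    (ih : ∀ F', rk F' + gaoRank ℓ n F < rk F + gaoRank ℓ n F' →
      total z F' ≤ lam * gaoRank ℓ n F' + (s - lam) * rk F')
    {u v : V} (huv : ℓ v = ℓ u + 1) (h1 : Linked F u v) (h2 : ℓ u ∉ linkSet ℓ n F) :
    total z F ≤ lam * gaoRank ℓ n F + (s - lam) * rk F := by
  obtain ⟨i, hi⟩ : ∃ i, ℓ u = i := ⟨_, rfl⟩
  rw [hi] at huv h2
  have hin : i < n := by have := h.level_le v; omega
  have hF : ∀ e ∈ F, e ∉ linkEdges G ℓ i := fun e he he' => h2 (mem_linkSet.2 ⟨hin, e, he, he'⟩)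
  set M := below ℓ (i + 2) \ below ℓ i with hM
  set X := edgesIn G M with hXdef
  set X₀ := X ∩ levelEdges G ℓ with hX₀def
  have memX : ∀ {p q} (hpq : G.Adj p q), (⟨s(p, q), hpq⟩ : G.edgeSet) ∈ X ↔
      (i ≤ ℓ p ∧ ℓ p < i + 2) ∧ (i ≤ ℓ q ∧ ℓ q < i + 2) := by
    intro p q hpq
    rw [hXdef, mem_edgesIn, hM, mem_below_sdiff, mem_below_sdiff]
  have hlev : (F ∪ X) ∩ levelEdges G ℓ = F ∩ levelEdges G ℓ ∪ X₀ :=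
    Finset.union_inter_distrib_right ..
  have hlink : linkSet ℓ n (F ∪ X) = insert i (linkSet ℓ n F) := by
    ext j
    rw [Finset.mem_insert, mem_linkSet, mem_linkSet]
    constructor
    · rintro ⟨hj, e, he, hej⟩
      obtain ⟨p, q, hpq, rfl⟩ := exists_eq_edge e
      rcases Finset.mem_union.1 he with he | he
      · exact Or.inr ⟨hj, _, he, hej⟩
      · rw [memX] at he
        rw [mem_linkEdges] at hej
        omega
    · rintro (rfl | ⟨hj, e, he, hej⟩)
      · obtain ⟨e, he⟩ := h.exists_linkEdge hin
        refine ⟨hin, e, Finset.mem_union_right _ ?_, he⟩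
        obtain ⟨p, q, hpq, rfl⟩ := exists_eq_edge e
        rw [memX]
        rw [mem_linkEdges] at he
        omega
      · exact ⟨hj, e, Finset.mem_union_left _ he, hej⟩
  have hcardlink : (linkSet ℓ n (F ∪ X)).card = (linkSet ℓ n F).card + 1 := by
    rw [hlink, Finset.card_insert_of_notMem h2]
  have hFX : F ∩ X ⊆ X₀ := by
    intro e he
    obtain ⟨p, q, hpq, rfl⟩ := exists_eq_edge e
    rw [Finset.mem_inter] at he
    have h3 := hF _ he.1
    rw [hX₀def, Finset.mem_inter, mem_levelEdges]
    refine ⟨he.2, ?_⟩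
    have h4 := he.2
    rw [memX] at h4
    rw [mem_linkEdges] at h3
    omega
  have hA : F ∩ X ⊆ F ∩ levelEdges G ℓ :=
    Finset.subset_inter Finset.inter_subset_left (hFX.trans Finset.inter_subset_right)
  have h3 := rk_union_add_le (X := X₀) hA
  rw [Finset.union_eq_right.2 hFX] at h3
  have hsub : X₀ ⊆ edgesIn G (layer ℓ i) ∪ edgesIn G (layer ℓ (i + 1)) := by
    intro e he
    obtain ⟨p, q, hpq, rfl⟩ := exists_eq_edge e
    rw [hX₀def, Finset.mem_inter, mem_levelEdges, memX] at he
    simp only [Finset.mem_union, mem_edgesIn, mem_layer]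
    omega
  have hsup : edgesIn G (layer ℓ i) ∪ edgesIn G (layer ℓ (i + 1)) ⊆ X₀ := by
    intro e he
    obtain ⟨p, q, hpq, rfl⟩ := exists_eq_edge e
    simp only [Finset.mem_union, mem_edgesIn, mem_layer] at he
    rw [hX₀def, Finset.mem_inter, mem_levelEdges, memX]
    omega
  have h4 : rk X₀ + 2 ≤ M.card := by
    have h5 := rk_mono hsub
    have h6 := rk_union_add_le (A := ∅) (B := edgesIn G (layer ℓ i))
      (X := edgesIn G (layer ℓ (i + 1))) (by simp)
    rw [Finset.empty_union] at h6
    have h7 : rk (edgesIn G (layer ℓ i)) + 1 ≤ (layer ℓ i).card :=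
      rk_edgesIn_add_one_le ⟨u, mem_layer.2 hi⟩ le_rfl
    have h8 : rk (edgesIn G (layer ℓ (i + 1))) + 1 ≤ (layer ℓ (i + 1)).card :=
      rk_edgesIn_add_one_le ⟨v, mem_layer.2 huv⟩ le_rfl
    have h9 : (layer ℓ i).card + (layer ℓ (i + 1)).card = M.card := by
      rw [← Finset.card_union_of_disjoint]
      · congr 1
        ext w
        rw [Finset.mem_union, mem_layer, mem_layer, hM, mem_below_sdiff]
        omega
      · rw [Finset.disjoint_left]
        intro w
        rw [mem_layer, mem_layer]
        omega
    omega
  -- `X₀` already spans `X` together with `F`, as it connects both levels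
  have hspan : rk (F ∪ X) ≤ rk (F ∪ X₀) := by
    refine Submodule.finrank_mono (edgeSpan_le_iff.2 fun e he => ?_)
    rcases Finset.mem_union.1 he with he | he
    · exact edgeVec_mem (Finset.mem_union_left _ he)
    have hsame : ∀ {p q : V}, ℓ p = ℓ q → i ≤ ℓ p → ℓ p < i + 2 → Linked (F ∪ X₀) p q := by
      intro p q hpq hp1 hp2
      refine (h.linked_layer hpq).mono (Finset.Subset.trans ?_ Finset.subset_union_right)
      refine Finset.Subset.trans ?_ hsup
      rcases (by omega : ℓ p = i ∨ ℓ p = i + 1) with hp | hp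
      · rw [hp]; exact Finset.subset_union_left
      · rw [hp]; exact Finset.subset_union_right
    have huv' : Linked (F ∪ X₀) u v := h1.mono Finset.subset_union_left
    obtain ⟨p, q, hpq, rfl⟩ := exists_eq_edge e
    rw [memX] at he
    change Linked (F ∪ X₀) p q
    rcases Nat.lt_trichotomy (ℓ p) (ℓ q) with hlt | heq | hlt
    · exact ((hsame (by omega) he.1.1 he.1.2).trans huv').trans
        (hsame (by omega) (by omega) (by omega))
    · exact hsame heq he.1.1 he.1.2
    · exact ((hsame (by omega) he.1.1 he.1.2).trans huv'.symm).trans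
        (hsame (by omega) (by omega) (by omega))
  have h5 := rk_union_add_le (X := X₀) (Finset.inter_subset_left : F ∩ levelEdges G ℓ ⊆ F)
  have h6 := h.le_total_edgesIn (a := i) (b := i + 2) (by omega) (by omega)
  have h7 := total_nonneg h.mem.1 (edgesBetween G (below ℓ i) (below ℓ (i + 2))ᶜ)
  have h8 : gaoRank ℓ n (F ∪ X) = rk (F ∩ levelEdges G ℓ ∪ X₀) + ((linkSet ℓ n F).card + 1) := by
    rw [gaoRank, hlev, hcardlink]
  have h9 : gaoRank ℓ n F = rk (F ∩ levelEdges G ℓ) + (linkSet ℓ n F).card := rfl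
  refine h.rank_inequality_of_union (X := X) (m := M.card) (by linarith) (by omega) (by omega)
    (ih _ (by omega))

/-- A component of `(V, F)` with vertices on both sides of the level `i`, but none on it:
delete the edges that jump over the level. -/
theorem rank_inequality_of_delete_jumps (h : IsLayered G z s lam n ℓ) {F : Finset G.edgeSet}
    (ih : ∀ F', rk F' + gaoRank ℓ n F < rk F + gaoRank ℓ n F' →
      total z F' ≤ lam * gaoRank ℓ n F' + (s - lam) * rk F')
    {u v : V} {i : ℕ} (hu : ℓ u < i) (hv : i < ℓ v) (h1 : Linked F u v)
    (h2 : ∀ w, ℓ w = i → ¬ Linked F u w) :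
    total z F ≤ lam * gaoRank ℓ n F + (s - lam) * rk F := by
  have hgao : gaoRank ℓ n (F \ jumpEdges G ℓ i) = gaoRank ℓ n F := by
    unfold gaoRank
    congr 2
    · ext e
      obtain ⟨p, q, hpq, rfl⟩ := exists_eq_edge e
      rw [Finset.mem_inter, Finset.mem_inter, Finset.mem_sdiff, mem_levelEdges, mem_jumpEdges]
      grind
    · ext j
      rw [mem_linkSet, mem_linkSet]
      refine and_congr_right fun _ => exists_congr fun e => ?_
      obtain ⟨p, q, hpq, rfl⟩ := exists_eq_edge e
      rw [Finset.mem_sdiff, mem_linkEdges, mem_jumpEdges]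
      grind
  have hrk : rk (F \ jumpEdges G ℓ i) < rk F := by
    refine Submodule.finrank_lt_finrank_of_lt
      (lt_of_le_of_ne (edgeSpan_mono Finset.sdiff_subset) fun heq => ?_)
    have h3 : Linked (F \ jumpEdges G ℓ i) u v := by rw [Linked, heq]; exact h1
    have h4 := h3.mem_of_closed (D := component F u ∩ below ℓ i) (by
      intro p q hpq he hp
      rw [Finset.mem_sdiff, mem_jumpEdges] at he
      rw [Finset.mem_inter, mem_below] at hp ⊢
      have hq := component_closed u p q hpq he.1 hp.1
      have := h2 q
      rw [← mem_component] at this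
      exact ⟨hq, by by_contra hcon; rcases (by omega : ℓ q = i ∨ i < ℓ q) with h | h <;> tauto⟩)
      (by rw [Finset.mem_inter, mem_component, mem_below]; exact ⟨Linked.refl _ _, hu⟩)
    rw [Finset.mem_inter, mem_below] at h4
    omega
  have h3 := ih (F \ jumpEdges G ℓ i) (by omega)
  have h4 := total_inter_add_sdiff z F (jumpEdges G ℓ i)
  have h5 := total_mono h.mem.1 (Finset.inter_subset_right : F ∩ jumpEdges G ℓ i ⊆ _)
  have h6 := h.total_jumpEdges_le (i := i) (by have := h.level_le v; omega)
  have h7 : (rk (F \ jumpEdges G ℓ i) : ℝ) + 1 ≤ rk F := by exact_mod_cast hrk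
  have h8 := mul_le_mul_of_nonneg_left h7 (sub_nonneg.2 h.le)
  rw [hgao] at h3
  linarith

/-- Two components of `(V, F)` cross the cut between the levels `i` and `i + 1`: delete the
cut. -/
theorem rank_inequality_of_delete_cut (h : IsLayered G z s lam n ℓ) {F : Finset G.edgeSet}
    (ih : ∀ F', rk F' + gaoRank ℓ n F < rk F + gaoRank ℓ n F' →
      total z F' ≤ lam * gaoRank ℓ n F' + (s - lam) * rk F')
    {i : ℕ} (hi : i ∈ linkSet ℓ n F) {u v u' v' : V} (hu : ℓ u ≤ i) (hv : i < ℓ v)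
    (huv : Linked F u v) (hu' : ℓ u' ≤ i) (hv' : i < ℓ v') (huv' : Linked F u' v')
    (hne : ¬ Linked F u u') :
    total z F ≤ lam * gaoRank ℓ n F + (s - lam) * rk F := by
  set C := cut G (below ℓ (i + 1)) with hC
  have memC : ∀ {p q} (hpq : G.Adj p q), (⟨s(p, q), hpq⟩ : G.edgeSet) ∈ C ↔
      (ℓ p ≤ i ∧ i < ℓ q) ∨ (ℓ q ≤ i ∧ i < ℓ p) := by
    intro p q hpq
    rw [hC, mem_cut, mem_below, mem_below]
    omega
  have hin : i < n := (mem_linkSet.1 hi).1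
  have hgao : gaoRank ℓ n (F \ C) + 1 = gaoRank ℓ n F := by
    have h1 : (F \ C) ∩ levelEdges G ℓ = F ∩ levelEdges G ℓ := by
      ext e
      obtain ⟨p, q, hpq, rfl⟩ := exists_eq_edge e
      rw [Finset.mem_inter, Finset.mem_inter, Finset.mem_sdiff, mem_levelEdges, memC]
      grind
    have h2 : linkSet ℓ n (F \ C) = (linkSet ℓ n F).erase i := by
      ext j
      rw [Finset.mem_erase, mem_linkSet, mem_linkSet]
      constructor
      · rintro ⟨hj, e, he, hej⟩
        refine ⟨?_, hj, e, (Finset.mem_sdiff.1 he).1, hej⟩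
        rintro rfl
        obtain ⟨p, q, hpq, rfl⟩ := exists_eq_edge e
        rw [Finset.mem_sdiff, memC] at he
        rw [mem_linkEdges] at hej
        omega
      · rintro ⟨hji, hj, e, he, hej⟩
        refine ⟨hj, e, Finset.mem_sdiff.2 ⟨he, ?_⟩, hej⟩
        obtain ⟨p, q, hpq, rfl⟩ := exists_eq_edge e
        rw [memC]
        rw [mem_linkEdges] at hej
        omega
    rw [gaoRank, gaoRank, h1, h2, add_assoc, Finset.card_erase_add_one hi]
  have hrk : rk (F \ C) + 2 ≤ rk F := by
    have hker : ∀ w, edgeSpan (F \ C) ≤ LinearMap.ker (sumOn (component F w ∩ below ℓ (i + 1))) := by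
      intro w
      refine edgeSpan_le_ker_sumOn fun p q hpq he hp => ?_
      rw [Finset.mem_sdiff, memC] at he
      rw [Finset.mem_inter, mem_below] at hp ⊢
      exact ⟨component_closed w p q hpq he.1 hp.1, by omega⟩
    set K := LinearMap.ker (sumOn (component F u ∩ below ℓ (i + 1))) with hK
    set K' := LinearMap.ker (sumOn (component F u' ∩ below ℓ (i + 1))) with hK'
    have h1 : Module.finrank (ZMod 2) (edgeSpan F ⊓ K' ⊓ K : Submodule (ZMod 2) (V → ZMod 2)) <
        Module.finrank (ZMod 2) (edgeSpan F ⊓ K' : Submodule (ZMod 2) (V → ZMod 2)) := by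
      refine Submodule.finrank_lt_finrank_of_lt (lt_of_le_of_ne inf_le_left fun heq => ?_)
      have h2 : edgeVec s(u, v) ∈ edgeSpan F ⊓ K' := by
        refine Submodule.mem_inf.2 ⟨huv, ?_⟩
        rw [hK', LinearMap.mem_ker, sumOn_edgeVec_eq_zero, Finset.mem_inter, Finset.mem_inter,
          mem_component, mem_component]
        exact ⟨fun h => absurd h.1.symm hne, fun h => absurd (huv.trans h.1.symm) hne⟩
      rw [← heq] at h2
      have h3 := (Submodule.mem_inf.1 h2).2
      rw [hK, LinearMap.mem_ker, sumOn_edgeVec_eq_zero, Finset.mem_inter, Finset.mem_inter,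
        mem_component, mem_below, mem_below] at h3
      have := (h3.1 ⟨Linked.refl _ _, by omega⟩).2
      omega
    have h2 : Module.finrank (ZMod 2) (edgeSpan F ⊓ K' : Submodule (ZMod 2) (V → ZMod 2)) <
        Module.finrank (ZMod 2) (edgeSpan F) := by
      refine Submodule.finrank_lt_finrank_of_lt (lt_of_le_of_ne inf_le_left fun heq => ?_)
      have h2 : edgeVec s(u', v') ∈ edgeSpan F ⊓ K' := by rw [heq]; exact huv'
      have h3 := (Submodule.mem_inf.1 h2).2
      rw [hK', LinearMap.mem_ker, sumOn_edgeVec_eq_zero, Finset.mem_inter, Finset.mem_inter,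
        mem_component, mem_below, mem_below] at h3
      have := (h3.1 ⟨Linked.refl _ _, by omega⟩).2
      omega
    have h3 : rk (F \ C) ≤
        Module.finrank (ZMod 2) (edgeSpan F ⊓ K' ⊓ K : Submodule (ZMod 2) (V → ZMod 2)) :=
      Submodule.finrank_mono (le_inf (le_inf (edgeSpan_mono Finset.sdiff_subset) (hker u')) (hker u))
    have h4 : rk F = Module.finrank (ZMod 2) (edgeSpan F) := rfl
    omega
  have h3 := ih (F \ C) (by omega)
  have h4 := total_inter_add_sdiff z F C
  have h5 := total_mono h.mem.1 (Finset.inter_subset_right : F ∩ C ⊆ _)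
  have h6 := h.cut_le (i + 1) (by omega) hin
  have h7 : (rk (F \ C) : ℝ) + 2 ≤ rk F := by exact_mod_cast hrk
  have h8 := mul_le_mul_of_nonneg_left h7 (sub_nonneg.2 h.le)
  have h9 : (gaoRank ℓ n F : ℝ) = gaoRank ℓ n (F \ C) + 1 := by exact_mod_cast hgao.symm
  rw [h9]
  linarith

/-- If none of the four changes of `F` above applies, then one edge between
each pair of consecutive levels, where `F` has one, suffices to span `F` together with the
edges of `F` inside the levels. -/
theorem rk_le_gaoRank (h : IsLayered G z s lam n ℓ) {F : Finset G.edgeSet}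
    (hA : ∀ u v, ℓ u = ℓ v → Linked F u v → Linked (F ∩ levelEdges G ℓ) u v)
    (hB : ∀ u v, ℓ v = ℓ u + 1 → Linked F u v → ℓ u ∈ linkSet ℓ n F)
    (hC : ∀ u v i, ℓ u < i → i < ℓ v → Linked F u v → ∃ w, ℓ w = i ∧ Linked F u w)
    (hD : ∀ i ∈ linkSet ℓ n F, ∀ u v u' v', ℓ u ≤ i → i < ℓ v → Linked F u v →
      ℓ u' ≤ i → i < ℓ v' → Linked F u' v' → Linked F u u') :
    rk F ≤ gaoRank ℓ n F := by
  have hedge : ∀ i ∈ linkSet ℓ n F, ∃ p q, ℓ p = i ∧ ℓ q = i + 1 ∧ Linked F p q := by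
    intro i hi
    obtain ⟨_, e, he, hei⟩ := mem_linkSet.1 hi
    obtain ⟨p, q, hpq, rfl⟩ := exists_eq_edge e
    have hl := linked_of_mem hpq he
    rcases (mem_linkEdges hpq).1 hei with h1 | h1
    · exact ⟨p, q, h1.1, h1.2, hl⟩
    · exact ⟨q, p, h1.1, h1.2, hl.symm⟩
  have : Nonempty V := ⟨(h.exists_level 0 (Nat.zero_le n)).choose⟩
  choose! p q hp hq hpq using hedge
  let R : Finset (V → ZMod 2) := (linkSet ℓ n F).image fun i => edgeVec s(p i, q i)
  set W := edgeSpan (F ∩ levelEdges G ℓ) ⊔ Submodule.span (ZMod 2) (R : Set (V → ZMod 2)) with hW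
  have key : ∀ d, ∀ u v, ℓ v = ℓ u + d → Linked F u v → edgeVec s(u, v) ∈ W := by
    intro d
    induction d with
    | zero => exact fun u v huv hl => Submodule.mem_sup_left (hA u v huv.symm hl)
    | succ d ihd =>
      intro u v huv hl
      obtain ⟨w, hw, hlw⟩ : ∃ w, ℓ w = ℓ u + 1 ∧ Linked F u w := by
        rcases Nat.eq_zero_or_pos d with rfl | hd
        · exact ⟨v, huv, hl⟩
        · exact hC u v (ℓ u + 1) (by omega) (by omega) hl
      have hi := hB u w hw hlw
      have hp' := hp _ hi
      have hq' := hq _ hi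
      have h1 : Linked F u (p (ℓ u)) :=
        hD _ hi u w _ _ le_rfl (by omega) hlw hp'.le (by omega) (hpq _ hi)
      have h2 : Linked F (q (ℓ u)) w := ((h1.trans (hpq _ hi)).symm).trans hlw
      rw [← edgeVec_add u w v, ← edgeVec_add u (q (ℓ u)) w, ← edgeVec_add u (p (ℓ u)) (q (ℓ u))]
      refine add_mem (add_mem (add_mem ?_ ?_) ?_) ?_
      · exact Submodule.mem_sup_left (hA _ _ hp'.symm h1)
      · exact Submodule.mem_sup_right (Submodule.subset_span
          (Finset.mem_coe.2 (Finset.mem_image_of_mem (fun i => edgeVec s(p i, q i)) hi)))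
      · exact Submodule.mem_sup_left (hA _ _ (by omega) h2)
      · exact ihd w v (by omega) (hlw.symm.trans hl)
  have hle : edgeSpan F ≤ W := by
    refine edgeSpan_le_iff.2 fun e he => ?_
    obtain ⟨a, b, hab, rfl⟩ := exists_eq_edge e
    have hl := linked_of_mem hab he
    rcases le_total (ℓ a) (ℓ b) with hle | hle
    · exact key _ a b (Nat.add_sub_of_le hle).symm hl
    · have := key _ b a (Nat.add_sub_of_le hle).symm hl.symm
      rwa [Sym2.eq_swap] at this
  have h1 : rk F ≤ Module.finrank (ZMod 2) W := Submodule.finrank_mono hle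
  have h2 := Submodule.finrank_add_le_finrank_add_finrank (edgeSpan (F ∩ levelEdges G ℓ))
    (Submodule.span (ZMod 2) (R : Set (V → ZMod 2)))
  have h3 : Module.finrank (ZMod 2) (Submodule.span (ZMod 2) (R : Set (V → ZMod 2))) ≤ R.card :=
    finrank_span_finset_le_card R
  have h4 : R.card ≤ (linkSet ℓ n F).card := Finset.card_image_le
  rw [← hW] at h2
  unfold gaoRank
  unfold rk at h1 ⊢
  omega

/-- The rank inequality: a layered point satisfies the inequality of the edge set `F` for the
weighted sum of the base polytopes of the matroid of Gao-trees and the graphic matroid. The induction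
is on the excess of the graphic rank of `F` over its rank in the matroid of Gao-trees. -/
theorem rank_inequality (h : IsLayered G z s lam n ℓ) (F : Finset G.edgeSet) :
    total z F ≤ lam * gaoRank ℓ n F + (s - lam) * rk F := by
  induction hm : rk F - gaoRank ℓ n F using Nat.strong_induction_on generalizing F with
  | _ m ihm =>
  have hs : 0 ≤ s := h.pos.le.trans h.le
  rcases Nat.lt_or_ge (gaoRank ℓ n F) (rk F) with hlt | hge
  · have ih : ∀ F', rk F' + gaoRank ℓ n F < rk F + gaoRank ℓ n F' →
        total z F' ≤ lam * gaoRank ℓ n F' + (s - lam) * rk F' :=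
      fun F' hF' => ihm _ (by omega) F' rfl
    by_contra hcon
    refine absurd (h.rk_le_gaoRank (F := F) ?_ ?_ ?_ ?_) (by omega)
    · intro u v huv hl
      by_contra hl'
      exact hcon (h.rank_inequality_of_fill_layer ih huv hl hl')
    · intro u v huv hl
      by_contra hl'
      exact hcon (h.rank_inequality_of_fill_two_layers ih huv hl hl')
    · intro u v i hu hv hl
      by_contra! hl'
      exact hcon (h.rank_inequality_of_delete_jumps ih hu hv hl hl')
    · intro i hi u v u' v' hu hv huv hu' hv' huv'
      by_contra hl'
      exact hcon (h.rank_inequality_of_delete_cut ih hi hu hv huv hu' hv' huv' hl')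
  · have h1 := total_le_rk hs h.mem F
    have h2 : (rk F : ℝ) ≤ gaoRank ℓ n F := by exact_mod_cast hge
    have := mul_le_mul_of_nonneg_left h2 h.pos.le
    linarith

end IsLayered

/-! ### Greedy bases and spanning trees -/

theorem rk_le_card (F : Finset G.edgeSet) : rk F ≤ F.card := by
  have h : Module.finrank (ZMod 2) (Submodule.span (ZMod 2)
      ((F.image fun e : G.edgeSet => edgeVec (e : Sym2 V) : Finset (V → ZMod 2)) : Set (V → ZMod 2))) ≤ _ :=
    finrank_span_finset_le_card _
  rw [Finset.coe_image] at h
  exact h.trans Finset.card_image_le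

theorem rk_union_le (A B : Finset G.edgeSet) : rk (A ∪ B) ≤ rk A + rk B := by
  have := rk_union_add_le (A := ∅) (B := A) (X := B) (by simp)
  rw [Finset.empty_union] at this
  omega

theorem card_inter_le_rk {T : Finset G.edgeSet} (h : rk T = T.card) (X : Finset G.edgeSet) :
    (T ∩ X).card ≤ rk (T ∩ X) := by
  have h1 := rk_union_le (T ∩ X) (T \ X)
  have h2 : T ∩ X ∪ T \ X = T := by rw [Finset.union_comm, Finset.sdiff_union_inter]
  rw [h2] at h1
  have h3 := rk_le_card (T \ X)
  have h4 := Finset.card_inter_add_card_sdiff T X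
  omega

/-- The greedy algorithm: some independent subset of `S` spans `{e ∈ S | a < c e}` by its own
elements of weight more than `a`, for all thresholds `a` at the same time. -/
theorem exists_greedy_basis (c : G.edgeSet → ℝ) (S : Finset G.edgeSet) :
    ∃ T ⊆ S, rk T = T.card ∧
      ∀ a : ℝ, edgeSpan (S.filter fun e => a < c e) ≤ edgeSpan (T.filter fun e => a < c e) := by
  induction S using Finset.induction_on_min_value c with
  | empty =>
    refine ⟨∅, le_rfl, ?_, fun a => by simp⟩
    have := rk_le_card (∅ : Finset G.edgeSet)
    simpa using this
  | insert e S heS hmin ih =>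
    obtain ⟨T, hTS, hT, hspan⟩ := ih
    by_cases he : edgeVec (e : Sym2 V) ∈ edgeSpan T
    · refine ⟨T, hTS.trans (Finset.subset_insert _ _), hT, fun a => ?_⟩
      refine edgeSpan_le_iff.2 fun x hx => ?_
      rw [Finset.mem_filter, Finset.mem_insert] at hx
      obtain ⟨rfl | hxS, hxa⟩ := hx
      · -- all elements of `T` are at least as heavy as `x`
        rwa [Finset.filter_true_of_mem fun y hy => hxa.trans_le (hmin y (hTS hy))]
      · exact hspan a (edgeVec_mem (Finset.mem_filter.2 ⟨hxS, hxa⟩))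
    · have heT : e ∉ T := fun h => heS (hTS h)
      refine ⟨insert e T, Finset.insert_subset_insert _ hTS, ?_, fun a => ?_⟩
      · refine le_antisymm (rk_le_card _) ?_
        rw [Finset.card_insert_of_notMem heT, ← hT]
        refine Submodule.finrank_lt_finrank_of_lt (lt_of_le_of_ne
          (edgeSpan_mono (Finset.subset_insert _ _)) fun heq => he ?_)
        rw [heq]
        exact edgeVec_mem (Finset.mem_insert_self _ _)
      · refine edgeSpan_le_iff.2 fun x hx => ?_
        rw [Finset.mem_filter, Finset.mem_insert] at hx
        obtain ⟨rfl | hxS, hxa⟩ := hx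
        · exact edgeVec_mem (Finset.mem_filter.2 ⟨Finset.mem_insert_self _ _, hxa⟩)
        · exact edgeSpan_mono (Finset.filter_subset_filter _ (Finset.subset_insert _ _))
            (hspan a (edgeVec_mem (Finset.mem_filter.2 ⟨hxS, hxa⟩)))

/-- Summation by parts: if `w` has nonnegative sums over all superlevel sets of `c` and total
sum zero, then `∑ c * w` is nonnegative. -/
theorem sum_mul_nonneg_of_superlevel {E : Type*} [Fintype E] (c w : E → ℝ) (h0 : ∑ e, w e = 0)
    (h : ∀ a : ℝ, 0 ≤ ∑ e with a < c e, w e) : 0 ≤ ∑ e, c e * w e := by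
  have key : ∀ S : Finset E, (∀ a : ℝ, 0 ≤ ∑ e ∈ S with a < c e, w e) →
      ∀ m : ℝ, (∀ e ∈ S, m ≤ c e) → 0 ≤ ∑ e ∈ S, (c e - m) * w e := by
    intro S
    induction S using Finset.strongInduction with
    | H S ih =>
    intro hS m hm
    rcases S.eq_empty_or_nonempty with rfl | hne
    · simp
    obtain ⟨e₀, he₀, hmin⟩ := S.exists_min_image c hne
    have h1 : ∑ e ∈ S, (c e - m) * w e =
        ∑ e ∈ S, (c e - c e₀) * w e + (c e₀ - m) * ∑ e ∈ S, w e := by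
      rw [Finset.mul_sum, ← Finset.sum_add_distrib]
      exact Finset.sum_congr rfl fun e _ => by ring
    have h2 : ∑ e ∈ S with c e₀ < c e, (c e - c e₀) * w e = ∑ e ∈ S, (c e - c e₀) * w e := by
      refine Finset.sum_filter_of_ne fun e he hne => ?_
      refine lt_of_le_of_ne (hmin e he) fun heq => hne ?_
      rw [heq, sub_self, zero_mul]
    have h3 : 0 ≤ ∑ e ∈ S, w e := by
      have := hS (c e₀ - 1)
      rwa [Finset.filter_true_of_mem fun e he => by linarith [hmin e he]] at this
    have h4 : 0 ≤ ∑ e ∈ S with c e₀ < c e, (c e - c e₀) * w e := by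
      refine ih (S.filter fun e => c e₀ < c e)
        (Finset.filter_ssubset.2 ⟨e₀, he₀, lt_irrefl _⟩) (fun a => ?_) _
        fun e he => (Finset.mem_filter.1 he).2.le
      rw [Finset.filter_filter]
      have := hS (max (c e₀) a)
      simpa only [max_lt_iff] using this
    rw [h1, ← h2]
    exact add_nonneg h4 (mul_nonneg (sub_nonneg.2 (hm _ he₀)) h3)
  obtain ⟨m, hm⟩ : ∃ m : ℝ, ∀ e, m ≤ c e := by
    obtain ⟨m, hm⟩ := (Set.finite_range c).bddBelow
    exact ⟨m, fun e => hm ⟨e, rfl⟩⟩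
  have h1 := key Finset.univ h m fun e _ => hm e
  have h2 : ∑ e, (c e - m) * w e = ∑ e, c e * w e - m * ∑ e, w e := by
    rw [Finset.mul_sum, ← Finset.sum_sub_distrib]
    exact Finset.sum_congr rfl fun e _ => by ring
  rwa [h2, h0, mul_zero, sub_zero] at h1

/-- `T` is a basis of the graphic matroid of a connected graph: independent, with `|V| - 1`
elements. -/
def IsGraphicBasis (T : Finset G.edgeSet) : Prop :=
  rk T = T.card ∧ T.card + 1 = Fintype.card V

theorem IsGraphicBasis.linked {T : Finset G.edgeSet} (h : IsGraphicBasis T) (u v : V) :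
    Linked T u v := by
  classical
  by_contra hcon
  -- otherwise the two sides of the component of `u` show that the rank is too small
  have h1 := rk_add_card_le (F := T) (fun w => decide (w ∈ component T u)) (by
    rintro (_ | _)
    · exact ⟨v, by simpa [mem_component] using hcon⟩
    · exact ⟨u, by simpa [mem_component] using Linked.refl T u⟩) (by
    intro p q hpq he
    have := linked_of_mem hpq he
    simp only [decide_eq_decide, mem_component]
    exact ⟨fun hp => hp.trans this, fun hq => hq.trans this.symm⟩)
  rw [Fintype.card_bool, h.1] at h1
  have := h.2
  omega

theorem IsGraphicBasis.isSpanningTree {T : Finset G.edgeSet} (h : IsGraphicBasis T) :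
    IsSpanningTree G T := by
  classical
  have hne : Nonempty V := Fintype.card_pos_iff.1 (by have := h.2; omega)
  rw [IsSpanningTree, SimpleGraph.isTree_iff_connected_and_card]
  constructor
  · rw [SimpleGraph.connected_iff]
    refine ⟨fun u v => ?_, hne⟩
    set H := SimpleGraph.fromEdgeSet ((fun e : G.edgeSet => (e : Sym2 V)) '' (T : Set G.edgeSet))
      with hH
    have h1 := (h.linked u v).mem_of_closed (D := Finset.univ.filter fun w => H.Reachable u w) (by
      intro p q hpq he hp
      simp only [Finset.mem_filter, Finset.mem_univ, true_and] at hp ⊢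
      refine hp.trans (SimpleGraph.Adj.reachable ?_)
      rw [hH, SimpleGraph.fromEdgeSet_adj]
      exact ⟨⟨_, he, rfl⟩, hpq.ne⟩) (by simp)
    simpa using h1
  · have h1 : (SimpleGraph.fromEdgeSet
        ((fun e : G.edgeSet => (e : Sym2 V)) '' (T : Set G.edgeSet))).edgeSet =
        (fun e : G.edgeSet => (e : Sym2 V)) '' (T : Set G.edgeSet) := by
      rw [SimpleGraph.edgeSet_fromEdgeSet, sdiff_eq_left, Set.disjoint_left]
      rintro _ ⟨e, _, rfl⟩ he
      exact G.not_isDiag_of_mem_edgeSet e.2 he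
    rw [h1, Nat.card_image_of_injective Subtype.val_injective, Nat.card_coe_set_eq,
      Set.ncard_coe_finset, Nat.card_eq_fintype_card]
    exact h.2

theorem convex_scaledPolytope (s : ℝ) : Convex ℝ (scaledPolytope G s) := by
  intro x hx y hy a b ha hb hab
  have htot : ∀ F, total (a • x + b • y) F = a * total x F + b * total y F := by
    intro F
    simp [total, Finset.sum_add_distrib, Finset.mul_sum]
  refine ⟨fun e => add_nonneg (mul_nonneg ha (hx.1 e)) (mul_nonneg hb (hy.1 e)), fun U hU => ?_, ?_⟩
  · rw [htot]
    have h1 := mul_le_mul_of_nonneg_left (hx.2.1 U hU) ha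
    have h2 := mul_le_mul_of_nonneg_left (hy.2.1 U hU) hb
    have h3 : a * (s * ((U.card : ℝ) - 1)) + b * (s * ((U.card : ℝ) - 1)) =
        s * ((U.card : ℝ) - 1) := by rw [← add_mul, hab, one_mul]
    linarith
  · rw [htot, hx.2.2, hy.2.2, ← add_mul, hab, one_mul]

theorem smul_mem_scaledPolytope {y : G.edgeSet → ℝ} (hy : y ∈ scaledPolytope G 1) {s : ℝ}
    (hs : 0 ≤ s) : s • y ∈ scaledPolytope G s := by
  have htot : ∀ F, total (s • y) F = s * total y F := by
    intro F
    simp [total, Finset.mul_sum]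
  refine ⟨fun e => mul_nonneg hs (hy.1 e), fun U hU => ?_, ?_⟩
  · rw [htot]
    have h1 := hy.2.1 U hU
    rw [one_mul] at h1
    exact mul_le_mul_of_nonneg_left h1 hs
  · rw [htot, hy.2.2, one_mul]

theorem IsGraphicBasis.incidenceVector_mem {T : Finset G.edgeSet} (h : IsGraphicBasis T) :
    incidenceVector T ∈ scaledPolytope G 1 := by
  refine ⟨fun e => ?_, fun U hU => ?_, ?_⟩
  · rw [incidenceVector]; split_ifs <;> norm_num
  · have h1 := card_inter_le_rk h.1 (edgesIn G U)
    have h2 := rk_edgesIn_add_one_le hU (Finset.inter_subset_right : T ∩ edgesIn G U ⊆ _)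
    have h3 : ((T ∩ edgesIn G U).card : ℝ) + 1 ≤ U.card := by exact_mod_cast (by omega)
    rw [total_incidenceVector]
    linarith
  · have h1 : (T.card : ℝ) + 1 = Fintype.card V := by exact_mod_cast h.2
    rw [total_incidenceVector, Finset.inter_univ]
    linarith

namespace IsLayered

variable {z : G.edgeSet → ℝ} {s lam : ℝ} {n : ℕ} {ℓ : V → ℕ}

theorem card_le_rk_univ (h : IsLayered G z s lam n ℓ) :
    Fintype.card V ≤ rk (Finset.univ : Finset G.edgeSet) + 1 := by
  have hs : 0 < s := h.pos.trans_le h.le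
  have h1 := total_le_rk hs.le h.mem Finset.univ
  rw [h.mem.2.2] at h1
  have h2 := le_of_mul_le_mul_left h1 hs
  have h3 : (Fintype.card V : ℝ) ≤ rk (Finset.univ : Finset G.edgeSet) + 1 := by linarith
  exact_mod_cast h3

theorem rk_add_one_le_card (h : IsLayered G z s lam n ℓ) (F : Finset G.edgeSet) :
    rk F + 1 ≤ Fintype.card V := by
  obtain ⟨v, -⟩ := h.exists_level 0 (Nat.zero_le n)
  rw [← Finset.card_univ]
  exact rk_edgesIn_add_one_le ⟨v, Finset.mem_univ v⟩ (by rw [edgesIn_univ]; exact F.subset_univ)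

/-- A basis of the graphic matroid that is optimal for the weights `c`. -/
theorem exists_greedy_tree (h : IsLayered G z s lam n ℓ) (c : G.edgeSet → ℝ) :
    ∃ T : Finset G.edgeSet, IsGraphicBasis T ∧
      ∀ a : ℝ, rk (Finset.univ.filter fun e => a < c e) ≤
        (T ∩ Finset.univ.filter fun e => a < c e).card := by
  obtain ⟨T, -, hT, hspan⟩ := exists_greedy_basis c Finset.univ
  have hle : ∀ a : ℝ, rk (Finset.univ.filter fun e => a < c e) ≤ rk (T.filter fun e => a < c e) :=
    fun a => Submodule.finrank_mono (hspan a)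
  refine ⟨T, ⟨hT, ?_⟩, fun a => ?_⟩
  · obtain ⟨m, hm⟩ := (Set.finite_range c).bddBelow
    have hm' : ∀ e, m - 1 < c e := fun e => by linarith [hm ⟨e, rfl⟩]
    have h1 := hle (m - 1)
    rw [Finset.filter_true_of_mem fun e _ => hm' e, Finset.filter_true_of_mem fun e _ => hm' e]
      at h1
    have h2 := h.card_le_rk_univ
    have h3 := h.rk_add_one_le_card T
    omega
  · refine (hle a).trans ((rk_le_card _).trans_eq ?_)
    congr 1
    ext e
    simp

/-- A Gao-tree for the chain of the sets `below ℓ i` that is optimal for the weights `c`: a greedy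
basis inside the levels, and a heaviest edge between each pair of consecutive levels. -/
theorem exists_greedy_gaoTree (h : IsLayered G z s lam n ℓ) (c : G.edgeSet → ℝ) :
    ∃ T : Finset G.edgeSet, IsGraphicBasis T ∧
      (∀ i, 1 ≤ i → i ≤ n → (T ∩ cut G (below ℓ i)).card = 1) ∧
      ∀ a : ℝ, gaoRank ℓ n (Finset.univ.filter fun e => a < c e) ≤
        (T ∩ Finset.univ.filter fun e => a < c e).card := by
  obtain ⟨T₀, hT₀, hrk₀, hspan⟩ := exists_greedy_basis c (levelEdges G ℓ)
  have hlink : ∀ i : Fin n, ∃ e ∈ linkEdges G ℓ i, ∀ e' ∈ linkEdges G ℓ i, c e' ≤ c e :=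
    fun i => Finset.exists_max_image _ c (h.exists_linkEdge i.2)
  choose g hg hmax using hlink
  have hginj : Function.Injective g := by
    intro i j hij
    have h1 := hg i
    have h2 := hg j
    rw [hij] at h1
    obtain ⟨p, q, hpq, he⟩ := exists_eq_edge (g j)
    rw [he, mem_linkEdges] at h1 h2
    ext
    omega
  set R : Finset G.edgeSet := Finset.univ.image g with hR
  have hdisj : Disjoint T₀ R := by
    rw [Finset.disjoint_left]
    intro e he heR
    obtain ⟨i, -, rfl⟩ := Finset.mem_image.1 heR
    have h1 := hT₀ he
    have h2 := hg i
    obtain ⟨p, q, hpq, he⟩ := exists_eq_edge (g i)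
    rw [he, mem_levelEdges] at h1
    rw [he, mem_linkEdges] at h2
    omega
  have hRcard : R.card = n := by
    rw [hR, Finset.card_image_of_injective _ hginj, Finset.card_univ, Fintype.card_fin]
  have hcard : (T₀ ∪ R).card = T₀.card + n := by
    rw [Finset.card_union_of_disjoint hdisj, hRcard]
  have hle : T₀.card + (n + 1) ≤ Fintype.card V := by
    rw [← hrk₀, ← Fintype.card_fin (n + 1)]
    refine rk_add_card_le (fun v => (⟨ℓ v, Nat.lt_succ_of_le (h.level_le v)⟩ : Fin (n + 1))) ?_ ?_
    · intro i
      obtain ⟨v, hv⟩ := h.exists_level i (Nat.le_of_lt_succ i.2)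
      exact ⟨v, Fin.ext hv⟩
    · intro u v huv he
      exact Fin.ext ((mem_levelEdges huv).1 (hT₀ he))
  -- all vertices are linked in `T₀ ∪ R`
  have hlevel : ∀ u v, ℓ u = ℓ v → Linked (T₀ ∪ R) u v := by
    intro u v huv
    obtain ⟨m, hm⟩ := (Set.finite_range c).bddBelow
    have hm' : ∀ e, m - 1 < c e := fun e => by linarith [hm ⟨e, rfl⟩]
    have h1 := hspan (m - 1)
    rw [Finset.filter_true_of_mem fun e _ => hm' e, Finset.filter_true_of_mem fun e _ => hm' e]
      at h1
    refine edgeSpan_mono Finset.subset_union_left (h1 ((h.linked_layer huv).mono ?_))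
    intro e he
    obtain ⟨p, q, hpq, rfl⟩ := exists_eq_edge e
    rw [mem_edgesIn, mem_layer, mem_layer] at he
    rw [mem_levelEdges]
    omega
  have hup : ∀ d, ∀ u v, ℓ v = ℓ u + d → Linked (T₀ ∪ R) u v := by
    intro d
    induction d with
    | zero => exact fun u v huv => hlevel u v huv.symm
    | succ d ihd =>
      intro u v huv
      have hin : ℓ u < n := by have := h.level_le v; omega
      have hmem : g ⟨ℓ u, hin⟩ ∈ T₀ ∪ R :=
        Finset.mem_union_right _ (Finset.mem_image_of_mem g (Finset.mem_univ _))
      obtain ⟨p, q, hp, hq, hl⟩ : ∃ p q, ℓ p = ℓ u ∧ ℓ q = ℓ u + 1 ∧ Linked (T₀ ∪ R) p q := by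
        have h2 := hg ⟨ℓ u, hin⟩
        obtain ⟨p, q, hpq, he⟩ := exists_eq_edge (g ⟨ℓ u, hin⟩)
        rw [he] at hmem h2
        have hl := linked_of_mem hpq hmem
        rcases (mem_linkEdges hpq).1 h2 with h3 | h3
        · exact ⟨p, q, h3.1, h3.2, hl⟩
        · exact ⟨q, p, h3.1, h3.2, hl.symm⟩
      exact ((hlevel u p hp.symm).trans hl).trans (ihd q v (by omega))
  have hall : ∀ u v, Linked (T₀ ∪ R) u v := by
    intro u v
    rcases le_total (ℓ u) (ℓ v) with huv | huv
    · exact hup _ u v (Nat.add_sub_of_le huv).symm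
    · exact (hup _ v u (Nat.add_sub_of_le huv).symm).symm
  have huniv : rk (Finset.univ : Finset G.edgeSet) ≤ rk (T₀ ∪ R) := by
    refine Submodule.finrank_mono (edgeSpan_le_iff.2 fun e _ => ?_)
    obtain ⟨p, q, hpq, rfl⟩ := exists_eq_edge e
    exact hall p q
  have h1 := h.card_le_rk_univ
  have h2 := rk_le_card (T₀ ∪ R)
  refine ⟨T₀ ∪ R, ⟨by omega, by omega⟩, ?_, fun a => ?_⟩
  · intro i hi1 hin
    obtain ⟨j, rfl⟩ : ∃ j, i = j + 1 := ⟨i - 1, by omega⟩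
    rw [Finset.card_eq_one]
    refine ⟨g ⟨j, hin⟩, ?_⟩
    ext e
    rw [Finset.mem_inter, Finset.mem_union, Finset.mem_singleton]
    constructor
    · rintro ⟨he | he, hcut⟩
      · have h3 := hT₀ he
        obtain ⟨p, q, hpq, rfl⟩ := exists_eq_edge e
        rw [mem_levelEdges] at h3
        rw [mem_cut, mem_below, mem_below] at hcut
        omega
      · obtain ⟨k, -, rfl⟩ := Finset.mem_image.1 he
        have h3 := hg k
        obtain ⟨p, q, hpq, he⟩ := exists_eq_edge (g k)
        rw [he, mem_linkEdges] at h3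
        rw [he, mem_cut, mem_below, mem_below] at hcut
        congr 1
        ext
        change (k : ℕ) = j
        omega
    · rintro rfl
      refine ⟨Or.inr (Finset.mem_image_of_mem g (Finset.mem_univ _)), ?_⟩
      have h3 := hg ⟨j, hin⟩
      obtain ⟨p, q, hpq, he⟩ := exists_eq_edge (g ⟨j, hin⟩)
      rw [he, mem_linkEdges] at h3
      rw [he, mem_cut, mem_below, mem_below]
      simp only at h3
      omega
  · set F := Finset.univ.filter fun e => a < c e with hF
    rw [Finset.union_inter_distrib_right, Finset.card_union_of_disjoint
      (hdisj.mono Finset.inter_subset_left Finset.inter_subset_left), gaoRank]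
    refine Nat.add_le_add ?_ ?_
    · have h3 : rk ((levelEdges G ℓ).filter fun e => a < c e) ≤ rk (T₀.filter fun e => a < c e) :=
        Submodule.finrank_mono (hspan a)
      have h4 : F ∩ levelEdges G ℓ = (levelEdges G ℓ).filter fun e => a < c e := by
        ext e; simp [hF, and_comm]
      have h5 : T₀ ∩ F = T₀.filter fun e => a < c e := by
        ext e; simp [hF]
      rw [h4, h5]
      exact h3.trans (rk_le_card _)
    · refine Finset.card_le_card_of_surjOn
        (fun e => if h : ∃ i : Fin n, g i = e then (h.choose : ℕ) else 0) ?_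
      intro i hi
      obtain ⟨hin, e, he, hei⟩ := mem_linkSet.1 (Finset.mem_coe.1 hi)
      refine ⟨g ⟨i, hin⟩, ?_, ?_⟩
      · rw [Finset.mem_coe, Finset.mem_inter]
        refine ⟨Finset.mem_image_of_mem g (Finset.mem_univ _), ?_⟩
        rw [hF, Finset.mem_filter] at he ⊢
        exact ⟨Finset.mem_univ _, he.2.trans_le (hmax ⟨i, hin⟩ e hei)⟩
      · have hex : ∃ j : Fin n, g j = g ⟨i, hin⟩ := ⟨_, rfl⟩
        simp only [dif_pos hex]
        rw [hginj hex.choose_spec]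

/-! ### Splitting off a combination of Gao-trees -/

open Pointwise in
/-- A layered point is `lam` times a convex combination of Gao-trees plus `s - lam` times a
point of the spanning tree polytope. -/
theorem exists_gaoPolytope_sub_mem (h : IsLayered G z s lam n ℓ) :
    ∃ y ∈ gaoPolytope G {A | ∃ i, 1 ≤ i ∧ i ≤ n ∧ A = below ℓ i},
      y ∈ scaledPolytope G 1 ∧ z - lam • y ∈ scaledPolytope G (s - lam) := by
  set B₁ : Set (Finset G.edgeSet) :=
    {T | IsGraphicBasis T ∧ ∀ i, 1 ≤ i → i ≤ n → (T ∩ cut G (below ℓ i)).card = 1}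
  set B₂ : Set (Finset G.edgeSet) := {T | IsGraphicBasis T}
  set H₁ := convexHull ℝ (incidenceVector '' B₁)
  set H₂ := convexHull ℝ (incidenceVector '' B₂)
  have hsub₂ : H₂ ⊆ scaledPolytope G 1 := by
    refine convexHull_min ?_ (convex_scaledPolytope 1)
    rintro _ ⟨T, hT, rfl⟩
    exact IsGraphicBasis.incidenceVector_mem hT
  have hsub₁ : H₁ ⊆ H₂ := convexHull_mono (Set.image_mono fun T hT => hT.1)
  have hgao : H₁ ⊆ gaoPolytope G {A | ∃ i, 1 ≤ i ∧ i ≤ n ∧ A = below ℓ i} := by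
    refine convexHull_mono (Set.image_mono fun T hT => ⟨hT.1.isSpanningTree, ?_⟩)
    rintro _ ⟨i, hi1, hin, rfl⟩
    exact hT.2 i hi1 hin
  have hmem : z ∈ lam • H₁ + (s - lam) • H₂ := by
    by_contra hz
    have hcomp₁ : IsCompact H₁ := (Set.toFinite _).isCompact_convexHull ℝ
    have hcomp₂ : IsCompact H₂ := (Set.toFinite _).isCompact_convexHull ℝ
    obtain ⟨f, u, hf, hfz⟩ := geometric_hahn_banach_closed_point
      (((convex_convexHull ℝ _).smul lam).add ((convex_convexHull ℝ _).smul (s - lam)))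
      ((hcomp₁.smul lam).add (hcomp₂.smul (s - lam))).isClosed hz
    set c : G.edgeSet → ℝ := fun e => f (Pi.single e 1) with hc
    have hfc : ∀ y : G.edgeSet → ℝ, f y = ∑ e, c e * y e := by
      intro y
      conv_lhs => rw [← Finset.univ_sum_single y]
      rw [map_sum]
      refine Finset.sum_congr rfl fun e _ => ?_
      have : (Pi.single e (y e) : G.edgeSet → ℝ) = y e • Pi.single e 1 := by
        rw [← Pi.single_smul, smul_eq_mul, mul_one]
      rw [this, map_smul, smul_eq_mul, mul_comm]
    obtain ⟨T₁, hT₁, hcut, hrk₁⟩ := h.exists_greedy_gaoTree c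
    obtain ⟨T₂, hT₂, hrk₂⟩ := h.exists_greedy_tree c
    have h1 := hf (lam • incidenceVector T₁ + (s - lam) • incidenceVector T₂)
      (Set.add_mem_add
        (Set.smul_mem_smul_set (subset_convexHull ℝ _ ⟨T₁, ⟨hT₁, hcut⟩, rfl⟩))
        (Set.smul_mem_smul_set (subset_convexHull ℝ _ ⟨T₂, hT₂, rfl⟩)))
    set w : G.edgeSet → ℝ :=
      lam • incidenceVector T₁ + (s - lam) • incidenceVector T₂ - z with hw
    have hsum : ∀ F, ∑ e ∈ F, w e =
        lam * ((T₁ ∩ F).card : ℝ) + (s - lam) * ((T₂ ∩ F).card : ℝ) - total z F := by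
      intro F
      rw [← total_incidenceVector, ← total_incidenceVector]
      simp [hw, total, Finset.sum_sub_distrib, Finset.sum_add_distrib, Finset.mul_sum]
    have h2 : 0 ≤ ∑ e, c e * w e := by
      refine sum_mul_nonneg_of_superlevel c w ?_ fun a => ?_
      · have h3 : (T₁.card : ℝ) + 1 = Fintype.card V := by exact_mod_cast hT₁.2
        have h4 : (T₂.card : ℝ) + 1 = Fintype.card V := by exact_mod_cast hT₂.2
        rw [hsum, Finset.inter_univ, Finset.inter_univ, h.mem.2.2, ← h3]
        have h5 : (T₂.card : ℝ) = T₁.card := by linarith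
        rw [h5]
        ring
      · rw [hsum]
        have h3 := h.rank_inequality (Finset.univ.filter fun e => a < c e)
        have h4 := mul_le_mul_of_nonneg_left (Nat.cast_le (α := ℝ).2 (hrk₁ a)) h.pos.le
        have h5 := mul_le_mul_of_nonneg_left (Nat.cast_le (α := ℝ).2 (hrk₂ a))
          (sub_nonneg.2 h.le)
        linarith
    rw [← hfc, hw, map_sub] at h2
    linarith
  obtain ⟨_, ⟨y, hy, rfl⟩, _, ⟨y', hy', rfl⟩, hz⟩ := hmem
  refine ⟨y, hgao hy, hsub₂ (hsub₁ hy), ?_⟩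
  have : z - lam • y = (s - lam) • y' := by
    rw [← hz]; simp
  rw [this]
  exact smul_mem_scaledPolytope (hsub₂ hy') (sub_nonneg.2 h.le)

end IsLayered

/-! ### Cuts of points of the spanning tree polytope -/

theorem total_cut_univ (x : G.edgeSet → ℝ) : total x (cut G Finset.univ) = 0 := by
  have h : cut G (Finset.univ : Finset V) = ∅ := by
    ext e
    obtain ⟨u, v, he, rfl⟩ := exists_eq_edge e
    simp [mem_cut]
  rw [h, total, Finset.sum_empty]

theorem total_edgesIn_compl (x : G.edgeSet → ℝ) (A : Finset V) :
    total x (edgesIn G Aᶜ) =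
      total x Finset.univ - total x (edgesIn G A) - total x (cut G A) := by
  have h : edgesBetween G A (Finset.univ : Finset V)ᶜ = ∅ := by
    ext e
    obtain ⟨u, v, he, rfl⟩ := exists_eq_edge e
    simp [mem_edgesBetween]
  have h1 := total_edgesIn_sdiff x (Finset.subset_univ A)
  rw [h, edgesIn_univ, total, total, total, total, total, Finset.sum_empty, add_zero] at h1
  rwa [Finset.compl_eq_univ_sdiff]

theorem one_le_total_cut {x : G.edgeSet → ℝ} (hx : x ∈ scaledPolytope G 1) {A : Finset V}
    (hA : A.Nonempty) (hA' : A ≠ Finset.univ) : 1 ≤ total x (cut G A) := by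
  have h1 := hx.2.1 A hA
  have h2 := hx.2.1 Aᶜ ((Finset.compl_ne_univ_iff_nonempty _).1 (by rwa [compl_compl]))
  have h3 := total_edgesIn_compl x A
  rw [hx.2.2] at h3
  have h4 : ((Aᶜ.card : ℕ) : ℝ) = Fintype.card V - A.card := by
    rw [Finset.card_compl, Nat.cast_sub (Finset.card_le_univ A)]
  linarith

/-- A cut of value one is tight for the polytope, which determines the degree sum of its
side. -/
theorem degree_of_total_cut_eq_one {x : G.edgeSet → ℝ} (hx : x ∈ scaledPolytope G 1) {A : Finset V}
    (hA : A.Nonempty) (hA' : A ≠ Finset.univ) (h : total x (cut G A) = 1) :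
    2 * total x (edgesIn G A) + total x (cut G A) = 2 * (A.card : ℝ) - 1 := by
  have h1 := hx.2.1 A hA
  have h2 := hx.2.1 Aᶜ ((Finset.compl_ne_univ_iff_nonempty _).1 (by rwa [compl_compl]))
  have h3 := total_edgesIn_compl x A
  rw [hx.2.2] at h3
  have h4 : ((Aᶜ.card : ℕ) : ℝ) = Fintype.card V - A.card := by
    rw [Finset.card_compl, Nat.cast_sub (Finset.card_le_univ A)]
  linarith

theorem gaoPolytope_anti {𝒞 𝒞' : Set (Finset V)} (h : 𝒞 ⊆ 𝒞') :
    gaoPolytope G 𝒞' ⊆ gaoPolytope G 𝒞 :=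
  convexHull_mono (Set.image_mono fun _ hT => ⟨hT.1, fun A hA => hT.2 A (h hA)⟩)

theorem total_cut_of_mem_gaoPolytope {𝒞 : Set (Finset V)} {y : G.edgeSet → ℝ}
    (hy : y ∈ gaoPolytope G 𝒞) {A : Finset V} (hA : A ∈ 𝒞) : total y (cut G A) = 1 := by
  have h : gaoPolytope G 𝒞 ⊆ {y | total y (cut G A) = 1} := by
    refine convexHull_min ?_ ?_
    · rintro _ ⟨T, hT, rfl⟩
      rw [Set.mem_ofPred_eq, total_incidenceVector, hT.2 A hA, Nat.cast_one]
    · intro p hp q hq a b _ _ hab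
      rw [Set.mem_ofPred_eq] at hp hq ⊢
      have : total (a • p + b • q) (cut G A) = a * total p (cut G A) + b * total q (cut G A) := by
        simp [total, Finset.sum_add_distrib, Finset.mul_sum]
      rw [this, hp, hq, mul_one, mul_one, hab]
  exact h hy

/-! ### Peeling off the layers of a chain-point -/

/-- The splitting of a layered point, for the members of a chain with indices in `I`. -/
theorem exists_gaoPolytope_sub_mem_of_chain {k : ℕ} {C : Fin (k + 1) → Finset V}
    (hC : IsVertexChain C) {z : G.edgeSet → ℝ} {s lam : ℝ} (hpos : 0 < lam) (hle : lam ≤ s)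
    (hz : z ∈ scaledPolytope G s) (I : Finset (Fin (k + 1)))
    (hcut : ∀ i ∈ I, total z (cut G (C i)) ≤ 2 * s - lam)
    (hdeg : ∀ i ∈ I, 2 * total z (edgesIn G (C i)) + total z (cut G (C i)) =
      s * (2 * ((C i).card : ℝ) - 1)) :
    ∃ y ∈ gaoPolytope G {A | ∃ i ∈ I, C i = A},
      y ∈ scaledPolytope G 1 ∧ z - lam • y ∈ scaledPolytope G (s - lam) := by
  set n := I.card
  let σ : Fin n ↪o Fin (k + 1) := I.orderEmbOfFin rfl
  have hσ : ∀ a, σ a ∈ I := fun a => I.orderEmbOfFin_mem rfl a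
  -- the level of `v` is the number of members of the chain that avoid `v`
  let ℓ : V → ℕ := fun v => (Finset.univ.filter fun a : Fin n => v ∉ C (σ a)).card
  have hmono : ∀ {a b : Fin n}, a ≤ b → C (σ a) ⊆ C (σ b) := fun hab =>
    hC.strictMono.monotone (σ.monotone hab)
  have hmem : ∀ v (a : Fin n), v ∈ C (σ a) ↔ ℓ v < a + 1 := by
    intro v a
    constructor
    · intro hv
      have h1 : (Finset.univ.filter fun b : Fin n => v ∉ C (σ b)) ⊆ Finset.Iio a := by
        intro b hb
        rw [Finset.mem_filter] at hb
        rw [Finset.mem_Iio]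
        by_contra hab
        exact hb.2 (hmono (not_lt.1 hab) hv)
      have h2 := Finset.card_le_card h1
      rw [Fin.card_Iio] at h2
      exact Nat.lt_succ_of_le h2
    · intro hv
      by_contra hcon
      have h1 : Finset.Iic a ⊆ Finset.univ.filter fun b : Fin n => v ∉ C (σ b) := by
        intro b hb
        rw [Finset.mem_filter]
        exact ⟨Finset.mem_univ _, fun hb' => hcon (hmono (Finset.mem_Iic.1 hb) hb')⟩
      have h2 := Finset.card_le_card h1
      rw [Fin.card_Iic] at h2
      exact absurd hv (not_lt.2 h2)
  have hbelow : ∀ a : Fin n, below ℓ (a + 1) = C (σ a) := by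
    intro a
    ext v
    rw [mem_below, hmem]
  have hbelow' : ∀ i, 1 ≤ i → i ≤ n → ∃ j ∈ I, below ℓ i = C j := by
    intro i h1 h2
    refine ⟨σ ⟨i - 1, by omega⟩, hσ _, ?_⟩
    rw [← hbelow]
    congr 1
    simp only
    omega
  have hlev : ∀ v, ℓ v ≤ n := fun v => by
    have := Finset.card_le_univ (Finset.univ.filter fun a : Fin n => v ∉ C (σ a))
    rwa [Fintype.card_fin] at this
  have hL : IsLayered G z s lam n ℓ := by
    refine ⟨hpos, hle, ?_, hlev, hz, ?_, ?_⟩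
    · intro m hm
      have hfst : ∀ v ∈ C 0, ℓ v = 0 := by
        intro v hv
        rw [Finset.card_eq_zero, Finset.filter_eq_empty_iff]
        exact fun a _ ha => ha (hC.strictMono.monotone (Fin.zero_le _) hv)
      rcases Nat.eq_zero_or_pos m with rfl | h0
      · obtain ⟨v, hv⟩ := hC.nonempty_zero
        exact ⟨v, hfst v hv⟩
      have hlow : ∀ v, v ∉ C (σ ⟨m - 1, by omega⟩) → m ≤ ℓ v := by
        intro v hv
        rw [hmem] at hv
        simp only at hv
        omega
      rcases hm.lt_or_eq with hlt | rfl
      · have h1 : C (σ ⟨m - 1, by omega⟩) ⊂ C (σ ⟨m, hlt⟩) :=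
          hC.strictMono (σ.strictMono (Fin.mk_lt_mk.2 (by omega)))
        obtain ⟨v, hv, hv'⟩ := Finset.exists_of_ssubset h1
        rw [hmem] at hv
        have := hlow v hv'
        simp only at hv
        exact ⟨v, by omega⟩
      · obtain ⟨v, hv⟩ : ∃ v, v ∉ C (Fin.last k) := by
          by_contra! hcon
          exact hC.last_ne_univ (Finset.eq_univ_iff_forall.2 hcon)
        refine ⟨v, le_antisymm (hlev v) (hlow v fun hv' => hv ?_)⟩
        exact hC.strictMono.monotone (Fin.le_last _) hv'
    · intro i h1 h2
      obtain ⟨j, hj, hij⟩ := hbelow' i h1 h2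
      rw [hij]
      exact hcut j hj
    · intro i h1 h2
      obtain ⟨j, hj, hij⟩ := hbelow' i h1 h2
      rw [hij]
      exact hdeg j hj
  obtain ⟨y, hy, hy1, hy2⟩ := hL.exists_gaoPolytope_sub_mem
  refine ⟨y, gaoPolytope_anti ?_ hy, hy1, hy2⟩
  rintro _ ⟨i, hi, rfl⟩
  obtain ⟨a, rfl⟩ : ∃ a, σ a = i := by
    have h1 : i ∈ Set.range σ := by
      rw [show Set.range σ = (I : Set (Fin (k + 1))) from I.range_orderEmbOfFin rfl]
      exact hi
    exact h1
  exact ⟨a + 1, by omega, a.2, (hbelow a).symm⟩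

/-- The degree condition of a chain-point, restated for the members of the chain. -/
theorem IsChainPoint.degree {k : ℕ} {C : Fin (k + 1) → Finset V} {x : G.edgeSet → ℝ}
    (hC : IsVertexChain C) (hx : IsChainPoint G C x) (i : Fin (k + 1)) :
    2 * total x (edgesIn G (C i)) + total x (cut G (C i)) = 2 * ((C i).card : ℝ) - 1 := by
  induction i using Fin.induction with
  | zero =>
    refine degree_of_total_cut_eq_one (mem_scaledPolytope_one.2 hx.mem_polytope)
      hC.nonempty_zero (fun h => hC.last_ne_univ ?_) hx.cut_zero
    exact Finset.univ_subset_iff.1 (h ▸ hC.strictMono.monotone (Fin.zero_le _))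
  | succ i ih =>
    have hsub : C i.castSucc ⊆ C i.succ := hC.strictMono.monotone (Fin.castSucc_lt_succ).le
    have h1 := hx.level_degrees i
    have h2 := Finset.sum_sdiff (f := fun v => total x (cut G {v})) hsub
    rw [h1, sum_total_cut_singleton, sum_total_cut_singleton] at h2
    have h3 : ((C i.succ \ C i.castSucc).card : ℝ) = (C i.succ).card - (C i.castSucc).card := by
      rw [Finset.card_sdiff_of_subset hsub, Nat.cast_sub (Finset.card_le_card hsub)]
    linarith

/-- A finite set of reals in `[1, 2)` that contains `1`, listed in decreasing order after the
value `2`. -/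
theorem exists_decreasing_enumeration (S : Finset ℝ) (h1 : (1 : ℝ) ∈ S)
    (hS : ∀ r ∈ S, 1 ≤ r ∧ r < 2) :
    ∃ (l : ℕ) (v : ℕ → ℝ), v 0 = 2 ∧ v l = 1 ∧ (∀ j < l, v (j + 1) < v j) ∧
      ∀ r, r ∈ S ↔ ∃ j < l, v (j + 1) = r := by
  let σ : Fin S.card ↪o ℝ := S.orderEmbOfFin rfl
  have hσ : ∀ a, σ a ∈ S := fun a => S.orderEmbOfFin_mem rfl a
  have hl : 0 < S.card := Finset.card_pos.2 ⟨1, h1⟩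
  have hrange : ∀ r ∈ S, ∃ a, σ a = r := by
    intro r hr
    have : r ∈ Set.range σ := by
      rw [show Set.range σ = (S : Set ℝ) from S.range_orderEmbOfFin rfl]
      exact hr
    exact this
  let v : ℕ → ℝ := fun j => if h : 1 ≤ j ∧ j ≤ S.card then σ ⟨S.card - j, by omega⟩ else 2
  have hv : ∀ j (h : 1 ≤ j ∧ j ≤ S.card), v j = σ ⟨S.card - j, by omega⟩ := fun j h => dif_pos h
  have hv0 : v 0 = 2 := dif_neg fun h => Nat.not_succ_le_zero 0 h.1
  refine ⟨S.card, v, hv0, ?_, ?_, fun r => ⟨fun hr => ?_, ?_⟩⟩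
  · obtain ⟨a, ha⟩ := hrange 1 h1
    rw [hv _ ⟨hl, le_rfl⟩]
    refine le_antisymm ?_ (hS _ (hσ _)).1
    rw [← ha]
    exact σ.monotone (Fin.le_def.2 (by simp))
  · intro j hj
    rw [hv (j + 1) ⟨by omega, hj⟩]
    rcases Nat.eq_zero_or_pos j with rfl | h0
    · exact (hS _ (hσ _)).2.trans_eq hv0.symm
    · rw [hv j ⟨h0, hj.le⟩]
      exact σ.strictMono (Fin.mk_lt_mk.2 (by omega))
  · obtain ⟨a, rfl⟩ := hrange r hr
    refine ⟨S.card - 1 - a, by omega, ?_⟩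
    rw [hv _ ⟨by omega, by omega⟩]
    congr 1
    ext
    simp only
    omega
  · rintro ⟨j, hj, rfl⟩
    rw [hv _ ⟨by omega, hj⟩]
    exact hσ _

theorem hasLayeredConvexCombination {k : ℕ} {C : Fin (k + 1) → Finset V} {x : G.edgeSet → ℝ}
    (hC : IsVertexChain C) (hx : IsChainPoint G C x) : HasLayeredConvexCombination G C x := by
  classical
  have hSp := mem_scaledPolytope_one.2 hx.mem_polytope
  have hne : ∀ i, (C i).Nonempty := fun i =>
    hC.nonempty_zero.mono (hC.strictMono.monotone (Fin.zero_le i))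
  have hnu : ∀ i, C i ≠ Finset.univ := fun i h => hC.last_ne_univ
    (Finset.univ_subset_iff.1 (h ▸ hC.strictMono.monotone (Fin.le_last i)))
  have hlt : ∀ i, total x (cut G (C i)) < 2 := by
    intro i
    by_cases h0 : i = 0
    · rw [h0, hx.cut_zero]; norm_num
    by_cases h1 : i = Fin.last k
    · rw [h1, hx.cut_last]; norm_num
    exact hx.cut_lt_two i h0 h1
  obtain ⟨l, v, hv0, hvl, hvanti, hvS⟩ := exists_decreasing_enumeration
    (Finset.univ.image fun i => total x (cut G (C i)))
    (Finset.mem_image.2 ⟨0, Finset.mem_univ _, hx.cut_zero⟩) (by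
      intro r hr
      obtain ⟨i, -, rfl⟩ := Finset.mem_image.1 hr
      exact ⟨one_le_total_cut hSp (hne i) (hnu i), hlt i⟩)
  have hge : ∀ j ≤ l, 1 ≤ v j := by
    intro j hj
    induction hj using Nat.decreasingInduction with
    | self => exact hvl.ge
    | of_succ j hj ih => exact ih.trans (hvanti j hj).le
  -- after `j` steps, the sets of size more than `v j` have been dropped from the chain
  have step : ∀ j ≤ l, ∃ y : ℕ → G.edgeSet → ℝ,
      (∀ i < j, y i ∈ gaoPolytope G {A | (∃ i', C i' = A) ∧ total x (cut G A) ≤ v (i + 1)}) ∧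
      x - ∑ i ∈ Finset.range j, (v i - v (i + 1)) • y i ∈ scaledPolytope G (v j - 1) ∧
      ∀ i', total x (cut G (C i')) ≤ v j →
        total (x - ∑ i ∈ Finset.range j, (v i - v (i + 1)) • y i) (cut G (C i')) =
          total x (cut G (C i')) - (2 - v j) ∧
        2 * total (x - ∑ i ∈ Finset.range j, (v i - v (i + 1)) • y i) (edgesIn G (C i')) +
          total (x - ∑ i ∈ Finset.range j, (v i - v (i + 1)) • y i) (cut G (C i')) =
          (v j - 1) * (2 * ((C i').card : ℝ) - 1) := by
    intro j
    induction j with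
    | zero =>
      intro _
      refine ⟨fun _ => 0, fun i hi => absurd hi (Nat.not_lt_zero i), ?_, fun i' _ => ?_⟩
      · rw [Finset.range_zero, Finset.sum_empty, sub_zero, hv0]
        norm_num
        exact hSp
      · rw [Finset.range_zero, Finset.sum_empty, sub_zero, hv0, hx.degree hC]
        constructor <;> ring
    | succ j ih =>
      intro hj
      obtain ⟨y, hy, hmem, hz⟩ := ih (by omega)
      set z := x - ∑ i ∈ Finset.range j, (v i - v (i + 1)) • y i with hzdef
      have hdec := hvanti j hj
      have h1 := hge (j + 1) hj
      obtain ⟨y', hy', hy1, hy2⟩ := exists_gaoPolytope_sub_mem_of_chain hC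
        (z := z) (s := v j - 1) (lam := v j - v (j + 1)) (by linarith) (by linarith) hmem
        (Finset.univ.filter fun i => total x (cut G (C i)) ≤ v (j + 1)) (by
          intro i hi
          have hi' := (Finset.mem_filter.1 hi).2
          rw [(hz i (hi'.trans hdec.le)).1]
          linarith) (by
          intro i hi
          exact (hz i ((Finset.mem_filter.1 hi).2.trans hdec.le)).2)
      have hsum : x - ∑ i ∈ Finset.range (j + 1),
          (v i - v (i + 1)) • Function.update y j y' i = z - (v j - v (j + 1)) • y' := by
        rw [Finset.sum_range_succ, Function.update_self, hzdef, ← sub_sub]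
        congr 2
        refine Finset.sum_congr rfl fun i hi => ?_
        rw [Function.update_of_ne (Finset.mem_range.1 hi).ne]
      refine ⟨Function.update y j y', fun i hi => ?_, ?_, fun i' hi' => ?_⟩
      · rcases Nat.lt_succ_iff_lt_or_eq.1 hi with hi | rfl
        · rw [Function.update_of_ne hi.ne]
          exact hy i hi
        · rw [Function.update_self]
          refine gaoPolytope_anti ?_ hy'
          rintro _ ⟨⟨i', rfl⟩, hi'⟩
          exact ⟨i', Finset.mem_filter.2 ⟨Finset.mem_univ _, hi'⟩, rfl⟩
      · rw [hsum]
        have : v (j + 1) - 1 = v j - 1 - (v j - v (j + 1)) := by ring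
        rw [this]
        exact hy2
      · have hcut' : total y' (cut G (C i')) = 1 := total_cut_of_mem_gaoPolytope hy'
          ⟨i', Finset.mem_filter.2 ⟨Finset.mem_univ _, hi'⟩, rfl⟩
        have hdeg' := degree_of_total_cut_eq_one hy1 (hne i') (hnu i') hcut'
        obtain ⟨hz1, hz2⟩ := hz i' (hi'.trans hdec.le)
        rw [hsum, total_sub_smul, total_sub_smul]
        rw [hcut'] at hdeg' ⊢
        have hE : total y' (edgesIn G (C i')) = (C i').card - 1 := by linarith
        rw [hE]
        constructor
        · linarith
        · linarith
  obtain ⟨y, hy, hmem, -⟩ := step l le_rfl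
  have hzero : x - ∑ i ∈ Finset.range l, (v i - v (i + 1)) • y i = 0 := by
    rw [hvl, sub_self] at hmem
    have h1 := hmem.2.2
    rw [zero_mul, total, Finset.sum_eq_zero_iff_of_nonneg fun e _ => hmem.1 e] at h1
    ext e
    exact h1 e (Finset.mem_univ e)
  have htel : ∀ j, ∑ i ∈ Finset.range j, (v i - v (i + 1)) = 2 - v j := by
    intro j
    rw [Finset.sum_range_sub', hv0]
  set lam : Fin l → ℝ := fun j => v j - v (j + 1) with hlam
  have hsum : ∑ j, lam j = 1 := by
    rw [hlam, Fin.sum_univ_eq_sum_range (fun j => v j - v (j + 1)), htel, hvl]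
    norm_num
  have hsize : ∀ j, layerSize lam j = v (j + 1) := by
    intro j
    have h1 : ∑ i ∈ Finset.Iic j, lam i = ∑ i ∈ Finset.range (j + 1), (v i - v (i + 1)) := by
      have h2 := Finset.sum_map (Finset.Iic j) Fin.valEmbedding fun i => v i - v (i + 1)
      rw [Fin.map_valEmbedding_Iic] at h2
      refine h2.symm.trans (Finset.sum_congr ?_ fun _ _ => rfl)
      ext i
      simp only [Finset.mem_Iic, Finset.mem_range]
      omega
    rw [layerSize, h1, htel]
    ring
  refine ⟨l, lam, ⟨?_, ?_, by rw [hsum]; norm_num⟩, fun j => sub_pos.2 (hvanti j j.2), hsum,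
    fun j => y j, fun j => ?_, ?_⟩
  · have hanti : ∀ b < l, ∀ a < b, v (b + 1) < v (a + 1) := by
      intro b
      induction b with
      | zero => exact fun _ a ha => absurd ha (Nat.not_lt_zero a)
      | succ b ihb =>
        intro hb a ha
        rcases Nat.lt_succ_iff_lt_or_eq.1 ha with h | rfl
        · exact (hvanti (b + 1) hb).trans (ihb (by omega) a h)
        · exact hvanti (a + 1) hb
    intro a b hab
    rw [hsize, hsize]
    exact hanti b b.2 a hab
  · ext r
    have h1 := hvS r
    simp only [Finset.mem_image, Finset.mem_univ, true_and] at h1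
    simp only [Set.mem_range, hsize]
    rw [h1]
    exact ⟨fun ⟨j, hj⟩ => ⟨j, j.2, hj⟩, fun ⟨j, hj, h⟩ => ⟨⟨j, hj⟩, h⟩⟩
  · rw [hsize]
    exact hy j j.2
  · rw [sub_eq_zero] at hzero
    rw [hlam, Fin.sum_univ_eq_sum_range (fun j => (v j - v (j + 1)) • y j)]
    exact hzero

/-! ### Subtour solutions and the theorem of Gottschalk and Vygen -/

theorem exists_coefficients_of_mem_gaoPolytope {𝒞 : Set (Finset V)} {y : G.edgeSet → ℝ}
    (hy : y ∈ gaoPolytope G 𝒞) :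
    ∃ p : Finset G.edgeSet → ℝ, (∀ T, 0 ≤ p T) ∧ (∀ T, p T ≠ 0 → IsGaoTree G 𝒞 T) ∧
      ∑ T, p T = 1 ∧ y = ∑ T, p T • incidenceVector T := by
  have h : gaoPolytope G 𝒞 ⊆ {y | ∃ p : Finset G.edgeSet → ℝ, (∀ T, 0 ≤ p T) ∧
      (∀ T, p T ≠ 0 → IsGaoTree G 𝒞 T) ∧ ∑ T, p T = 1 ∧
      y = ∑ T, p T • incidenceVector T} := by
    refine convexHull_min ?_ ?_
    · rintro _ ⟨T, hT, rfl⟩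
      refine ⟨Pi.single T 1, fun T' => ?_, fun T' hT' => ?_, ?_, ?_⟩
      · rw [Pi.single_apply]; split_ifs <;> norm_num
      · rw [Pi.single_apply] at hT'
        split_ifs at hT' with h
        · rwa [h]
        · exact absurd rfl hT'
      · simp
      · rw [Finset.sum_eq_single T] <;> simp +contextual
    · rintro y ⟨p, hp0, hpG, hp1, rfl⟩ y' ⟨q, hq0, hqG, hq1, rfl⟩ a b ha hb hab
      refine ⟨fun T => a * p T + b * q T,
        fun T => add_nonneg (mul_nonneg ha (hp0 T)) (mul_nonneg hb (hq0 T)), fun T hT => ?_, ?_, ?_⟩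
      · by_cases h : p T = 0
        · refine hqG T fun h' => hT ?_
          change a * p T + b * q T = 0
          rw [h, h', mul_zero, mul_zero, add_zero]
        · exact hpG T h
      · rw [Finset.sum_add_distrib, ← Finset.mul_sum, ← Finset.mul_sum, hp1, hq1, mul_one, mul_one,
          hab]
      · rw [Finset.smul_sum, Finset.smul_sum, ← Finset.sum_add_distrib]
        refine Finset.sum_congr rfl fun T _ => ?_
        rw [add_smul, mul_smul, mul_smul]
  exact h hy

/-- A layered convex combination with respect to the chain of narrow cuts is a combination as in
the theorem of Gottschalk and Vygen. -/
theorem hasGottschalkVygenCombination_of_layered {s t : V} {x : G.edgeSet → ℝ} {k : ℕ}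
    {C : Fin (k + 1) → Finset V}
    (hC : Set.range C = {A | s ∈ A ∧ t ∉ A ∧ total x (cut G A) < 2})
    (h1 : ∃ i, total x (cut G (C i)) = 1) (h : HasLayeredConvexCombination G C x) :
    HasGottschalkVygenCombination G s t x := by
  classical
  obtain ⟨l, lam, hlay, hpos, hsum, y, hy, hx⟩ := h
  choose q hq0 hqG hq1 hqy using fun j => exists_coefficients_of_mem_gaoPolytope (hy j)
  refine ⟨fun T => ∑ j, lam j * q j T,
    fun T => Finset.sum_nonneg fun j _ => mul_nonneg (hpos j).le (hq0 j T), fun T hT => ?_, ?_, ?_,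
    fun r hr0 hr1 => ?_⟩
  · obtain ⟨j, -, hj⟩ := Finset.exists_ne_zero_of_sum_ne_zero hT
    exact (hqG j T (right_ne_zero_of_mul hj)).1
  · rw [Finset.sum_comm, ← hsum]
    refine Finset.sum_congr rfl fun j _ => ?_
    rw [← Finset.mul_sum, hq1, mul_one]
  · simp only [Finset.sum_smul]
    rw [Finset.sum_comm]
    conv_lhs => rw [hx]
    refine Finset.sum_congr rfl fun j _ => ?_
    rw [hqy j, Finset.smul_sum]
    refine Finset.sum_congr rfl fun T _ => ?_
    rw [mul_smul]
  · rcases hr0.eq_or_lt with rfl | hr0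
    · exact Finset.sum_nonneg fun T _ =>
        Finset.sum_nonneg fun j _ => mul_nonneg (hpos j).le (hq0 j T)
    -- `j₀` is the first layer whose size is at most `2 - r`
    obtain ⟨j₀, hj₀, hmin⟩ : ∃ j₀, layerSize lam j₀ ≤ 2 - r ∧
        ∀ j, layerSize lam j ≤ 2 - r → j₀ ≤ j := by
      obtain ⟨i, hi⟩ := h1
      obtain ⟨j, hj⟩ : (1 : ℝ) ∈ Set.range (layerSize lam) := by
        rw [hlay.range_eq]; exact ⟨i, hi⟩
      obtain ⟨j₀, hj₀, hmin⟩ := Finset.exists_min_image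
        (Finset.univ.filter fun j => layerSize lam j ≤ 2 - r) id
        ⟨j, Finset.mem_filter.2 ⟨Finset.mem_univ _, by linarith⟩⟩
      exact ⟨j₀, (Finset.mem_filter.1 hj₀).2, fun j hj =>
        hmin j (Finset.mem_filter.2 ⟨Finset.mem_univ _, hj⟩)⟩
    have hsub : ∀ j ≤ j₀, {A | s ∈ A ∧ t ∉ A ∧ total x (cut G A) ≤ 2 - r} ⊆
        {A | (∃ i, C i = A) ∧ total x (cut G A) ≤ layerSize lam j} := by
      rintro j hj A ⟨hs, ht, hA⟩
      have h2 : A ∈ Set.range C := by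
        rw [hC]; exact ⟨hs, ht, by linarith⟩
      obtain ⟨i, rfl⟩ := h2
      obtain ⟨j', hj'⟩ : total x (cut G (C i)) ∈ Set.range (layerSize lam) := by
        rw [hlay.range_eq]; exact ⟨i, rfl⟩
      refine ⟨⟨i, rfl⟩, ?_⟩
      rw [← hj'] at hA ⊢
      exact hlay.strictAnti.antitone (hj.trans (hmin j' hA))
    rw [Finset.sum_comm]
    have h2 : ∑ j ∈ Finset.Iic j₀, lam j = 2 - layerSize lam j₀ := by
      rw [layerSize]; ring
    have h3 : ∑ j ∈ Finset.Iic j₀, lam j ≤ ∑ j ∈ Finset.Iic j₀,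
        ∑ T with IsGaoTree G {A | s ∈ A ∧ t ∉ A ∧ total x (cut G A) ≤ 2 - r} T,
          lam j * q j T := by
      refine Finset.sum_le_sum fun j hj => ?_
      rw [← Finset.mul_sum, Finset.sum_filter_of_ne, hq1, mul_one]
      intro T _ hT
      have h4 := hqG j T hT
      exact ⟨h4.1, fun A hA => h4.2 A (hsub j (Finset.mem_Iic.1 hj) hA)⟩
    have h5 := Finset.sum_le_sum_of_subset_of_nonneg (Finset.subset_univ (Finset.Iic j₀))
      (f := fun j => ∑ T with IsGaoTree G {A | s ∈ A ∧ t ∉ A ∧ total x (cut G A) ≤ 2 - r} T,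
          lam j * q j T)
      fun j _ _ => Finset.sum_nonneg fun T _ => mul_nonneg (hpos j).le (hq0 j T)
    linarith

namespace IsSubtourSolution

variable {s t : V} {x : G.edgeSet → ℝ}

theorem source_ne_target (h : IsSubtourSolution G s t x) : s ≠ t := by
  rintro rfl
  have h1 := sum_total_cut_singleton x Finset.univ
  rw [edgesIn_univ, total_cut_univ, h.mem_polytope.2.2,
    ← Finset.add_sum_erase _ _ (Finset.mem_univ s), h.degree_source,
    Finset.sum_congr rfl fun v hv => h.degree_inner v (Finset.ne_of_mem_erase hv)
      (Finset.ne_of_mem_erase hv), Finset.sum_const, Finset.card_erase_of_mem (Finset.mem_univ s),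
    Finset.card_univ, nsmul_eq_mul, Nat.cast_sub (Fintype.card_pos_iff.2 ⟨s⟩)] at h1
  push_cast at h1
  linarith

/-- A cut around a set that avoids both `s` and `t` is never narrow. -/
theorem two_le_total_cut (h : IsSubtourSolution G s t x) {A : Finset V} (hA : A.Nonempty)
    (hs : s ∉ A) (ht : t ∉ A) : 2 ≤ total x (cut G A) := by
  have h1 := sum_total_cut_singleton x A
  rw [Finset.sum_congr rfl fun v hv => h.degree_inner v (fun h' => hs (h' ▸ hv))
    (fun h' => ht (h' ▸ hv)), Finset.sum_const, nsmul_eq_mul] at h1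
  have h2 := h.mem_polytope.2.1 A hA
  linarith

theorem narrow_cuts_nested (h : IsSubtourSolution G s t x) {A B : Finset V}
    (hA : s ∈ A ∧ t ∉ A ∧ total x (cut G A) < 2) (hB : s ∈ B ∧ t ∉ B ∧ total x (cut G B) < 2) :
    A ⊆ B ∨ B ⊆ A := by
  by_contra! hcon
  have h1 := h.two_le_total_cut (Finset.sdiff_nonempty.2 hcon.1)
    (fun h' => (Finset.mem_sdiff.1 h').2 hB.1) (fun h' => hA.2.1 (Finset.mem_sdiff.1 h').1)
  have h2 := h.two_le_total_cut (Finset.sdiff_nonempty.2 hcon.2)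
    (fun h' => (Finset.mem_sdiff.1 h').2 hA.1) (fun h' => hB.2.1 (Finset.mem_sdiff.1 h').1)
  have h3 := total_cut_sdiff_add_le h.mem_polytope.1 A B
  linarith [hA.2.2, hB.2.2]

/-- The narrow cuts of a subtour solution form a chain from `{s}` to `V ∖ {t}`, for which the
solution is a chain-point. -/
theorem exists_chain (h : IsSubtourSolution G s t x) :
    ∃ (k : ℕ) (C : Fin (k + 1) → Finset V), IsVertexChain C ∧
      Set.range C = {A | s ∈ A ∧ t ∉ A ∧ total x (cut G A) < 2} ∧
      C 0 = {s} ∧ C (Fin.last k) = Finset.univ.erase t ∧ IsChainPoint G C x := by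
  classical
  have hst := h.source_ne_target
  set 𝒩 : Finset (Finset V) :=
    Finset.univ.filter fun A => s ∈ A ∧ t ∉ A ∧ total x (cut G A) < 2 with h𝒩
  have mem𝒩 : ∀ {A}, A ∈ 𝒩 ↔ s ∈ A ∧ t ∉ A ∧ total x (cut G A) < 2 := by simp [h𝒩]
  have hs𝒩 : {s} ∈ 𝒩 := by
    refine mem𝒩.2 ⟨Finset.mem_singleton_self s, fun h' => hst (Finset.mem_singleton.1 h').symm, ?_⟩
    rw [h.degree_source]; norm_num
  have hcutt : total x (cut G (Finset.univ.erase t)) = 1 := by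
    rw [← h.degree_target, ← cut_compl {t}]
    congr 2
    ext v; simp
  have ht𝒩 : Finset.univ.erase t ∈ 𝒩 := by
    refine mem𝒩.2 ⟨Finset.mem_erase.2 ⟨hst, Finset.mem_univ s⟩, Finset.notMem_erase t _, ?_⟩
    rw [hcutt]; norm_num
  -- the members of the chain are listed by cardinality
  set I : Finset ℕ := 𝒩.image Finset.card with hI
  obtain ⟨k, hk⟩ : ∃ k, I.card = k + 1 := by
    have : 0 < I.card := Finset.card_pos.2 ⟨_, Finset.mem_image_of_mem _ hs𝒩⟩
    exact ⟨I.card - 1, by omega⟩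
  have hex : ∀ i : Fin (k + 1), ∃ A ∈ 𝒩, A.card = I.orderEmbOfFin hk i := fun i =>
    Finset.mem_image.1 (I.orderEmbOfFin_mem hk i)
  choose C hC𝒩 hCcard using hex
  have hmono : StrictMono C := by
    intro i j hij
    have h1 : (C i).card < (C j).card := by
      rw [hCcard, hCcard]
      exact (I.orderEmbOfFin hk).strictMono hij
    rcases h.narrow_cuts_nested (mem𝒩.1 (hC𝒩 i)) (mem𝒩.1 (hC𝒩 j)) with h2 | h2
    · exact lt_of_le_of_ne h2 fun h3 => by rw [h3] at h1; exact lt_irrefl _ h1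
    · exact absurd (Finset.card_le_card h2) (not_le.2 h1)
  have hrange : ∀ A ∈ 𝒩, ∃ i, C i = A := by
    intro A hA
    have h1 : A.card ∈ Set.range (I.orderEmbOfFin hk) := by
      rw [I.range_orderEmbOfFin hk]
      exact Finset.mem_coe.2 (Finset.mem_image_of_mem _ hA)
    obtain ⟨i, hi⟩ := h1
    have h2 : (C i).card = A.card := by rw [hCcard, hi]
    refine ⟨i, ?_⟩
    rcases h.narrow_cuts_nested (mem𝒩.1 (hC𝒩 i)) (mem𝒩.1 hA) with h3 | h3
    · exact Finset.eq_of_subset_of_card_le h3 h2.ge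
    · exact (Finset.eq_of_subset_of_card_le h3 h2.le).symm
  have hzero : C 0 = {s} := by
    obtain ⟨i, hi⟩ := hrange _ hs𝒩
    refine le_antisymm ?_ (Finset.singleton_subset_iff.2 (mem𝒩.1 (hC𝒩 0)).1)
    rw [← hi]
    exact hmono.monotone (Fin.zero_le i)
  have hlast : C (Fin.last k) = Finset.univ.erase t := by
    obtain ⟨i, hi⟩ := hrange _ ht𝒩
    refine le_antisymm (fun v hv => Finset.mem_erase.2 ⟨?_, Finset.mem_univ v⟩) ?_
    · rintro rfl
      exact (mem𝒩.1 (hC𝒩 _)).2.1 hv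
    · rw [← hi]
      exact hmono.monotone (Fin.le_last i)
  refine ⟨k, C, ⟨?_, hmono, ?_⟩, ?_, hzero, hlast, h.mem_polytope, ?_, ?_, ?_, ?_⟩
  · rw [hzero]; exact Finset.singleton_nonempty s
  · rw [hlast]
    exact fun h' => Finset.notMem_erase t Finset.univ (by rw [h']; exact Finset.mem_univ t)
  · ext A
    rw [Set.mem_ofPred_eq, ← mem𝒩]
    exact ⟨fun ⟨i, hi⟩ => hi ▸ hC𝒩 i, hrange A⟩
  · rw [hzero, h.degree_source]
  · rw [hlast, hcutt]
  · exact fun i _ _ => (mem𝒩.1 (hC𝒩 i)).2.2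
  · intro i
    rw [Finset.sum_congr rfl fun v hv => h.degree_inner v ?_ ?_, Finset.sum_const, nsmul_eq_mul,
      mul_comm]
    · rintro rfl
      exact (Finset.mem_sdiff.1 hv).2 (mem𝒩.1 (hC𝒩 _)).1
    · rintro rfl
      exact (mem𝒩.1 (hC𝒩 _)).2.1 (Finset.mem_sdiff.1 hv).1

end IsSubtourSolution

end PathTSP

theorem theorem1 {V : Type*} [Fintype V] [DecidableEq V] (G : SimpleGraph V)
    [DecidableRel G.Adj] :
    (∀ (k : ℕ) (C : Fin (k + 1) → Finset V) (x : G.edgeSet → ℝ),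
      PathTSP.IsVertexChain C → PathTSP.IsChainPoint G C x →
        PathTSP.HasLayeredConvexCombination G C x) ∧
    (∀ (s t : V) (x : G.edgeSet → ℝ), PathTSP.IsSubtourSolution G s t x →
      (∃ (k : ℕ) (C : Fin (k + 1) → Finset V),
        PathTSP.IsVertexChain C ∧
        Set.range C = {A | s ∈ A ∧ t ∉ A ∧ PathTSP.total x (PathTSP.cut G A) < 2} ∧
        C 0 = {s} ∧ C (Fin.last k) = Finset.univ.erase t ∧
        PathTSP.IsChainPoint G C x ∧
        PathTSP.HasLayeredConvexCombination G C x) ∧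
      PathTSP.HasGottschalkVygenCombination G s t x) := by
  refine ⟨fun k C x hC hx => PathTSP.hasLayeredConvexCombination hC hx, fun s t x hx => ?_⟩
  obtain ⟨k, C, hC, hrange, hzero, hlast, hpt⟩ := hx.exists_chain
  have hlay := PathTSP.hasLayeredConvexCombination hC hpt
  exact ⟨⟨k, C, hC, hrange, hzero, hlast, hpt, hlay⟩,
    PathTSP.hasGottschalkVygenCombination_of_layered hrange ⟨0, hpt.cut_zero⟩ hlay⟩
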